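/- For $r>0$ let $\mathbb S^2_r=\{x\in\mathbb R^3:\|x\|=r\}$, with the chordal (Euclidean) distance and its 2-dimensional surface measure $\mu$. Let $\chi_m(\mathbb S^2_r)$ be the least $k$ for which there is a map $\varphi:\mathbb S^2_r\to\{1,\dots,k\}$ such that every color class $\varphi^{-1}(i)$ is $\mu$-measurable (i.e. measurable for the completion of $\mu$) and $\varphi(x)\ne\varphi(y)$ whenever $\|x-y\|=1$ (with $\chi_m(\mathbb S^2_r)=\infty$ if there is no such $k$). **Theorem 1.1.** Let $r>\frac1{\sqrt3}$ and write $\theta=2\arcsin\left(\frac{r}{\sqrt{4r^2-1}}\right)=c\,\pi$ with $c\in\mathbb R$. If $c$ is irrational, or if $c=\frac pq$ with $p,q\in\mathbb N$, $q>0$, $\gcd(p,q)=1$ and $p$ even, then $\chi_m(\mathbb S^2_r)\ge 5$. -/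

import Mathlib

open MeasureTheory

/-- The unit-distance graph of a metric space `M`: the vertices are all the points of `M`, and two
points are adjacent exactly when their distance is `1`. -/
def unitDistanceGraph (M : Type*) [MetricSpace M] : SimpleGraph M where
  Adj x y := dist x y = 1
  symm := ⟨fun x y h => by rwa [dist_comm] at h⟩
  loopless := ⟨fun x h => by simp at h⟩

/-- There is a proper coloring of the unit-distance graph of `M` with `k` available colors in which
every color class is `μ`-measurable, that is, measurable for the completion of `μ`. -/
def MeasurablyColorable (M : Type*) [MetricSpace M] [MeasurableSpace M] (μ : Measure M)
    (k : ℕ) : Prop :=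
  ∃ φ : (unitDistanceGraph M).Coloring (Fin k), ∀ i : Fin k, NullMeasurableSet (φ ⁻¹' {i}) μ

/-- The measurable chromatic number of `M` with respect to `μ`: the least number of colors in a
proper coloring with measurable color classes (`⊤` if no finite number suffices). -/
noncomputable def measurableChromaticNumber (M : Type*) [MetricSpace M] [MeasurableSpace M]
    (μ : Measure M) : ℕ∞ :=
  ⨅ k ∈ {k : ℕ | MeasurablyColorable M μ k}, (k : ℕ∞)

/-- The 2-sphere of radius `r` in Euclidean 3-space; as a subtype of `ℝ³` it carries the chordal
distance and the Borel sigma-algebra. -/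
abbrev TwoSphere (r : ℝ) : Type :=
  Metric.sphere (0 : EuclideanSpace ℝ (Fin 3)) r

/-- The 2-dimensional measure on the sphere: the 2-dimensional Hausdorff measure of the chordal
distance, which is the surface area up to a constant factor. -/
noncomputable def sphereMeasure (r : ℝ) : Measure (TwoSphere r) :=
  Measure.hausdorffMeasure 2

/-- The measurable chromatic number of the 2-sphere of radius `r`. -/
noncomputable def sphereMeasurableChromaticNumber (r : ℝ) : ℕ∞ :=
  measurableChromaticNumber (TwoSphere r) (sphereMeasure r)

open Metric Set Filter Topology
open scoped ENNReal NNReal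

/-! Suppose four measurable colors suffice. Replace each class by the set of points where it has
density one. A bi-Lipschitz local map moving every point by distance exactly one shows that a class
of density one at `y` has density zero at every point at distance one from `y`
(`mem_zeroDensityPoints_of_dist_eq_one`). The exceptional points, where no class has density one,
form a null set by Lebesgue's theorem, but they do exist by a Baire and connectedness argument
(`exists_forall_not_mem_zeroDensityPoints_compl`).

An exceptional point can be chosen so that almost every point of the unit-distance circle about it
is not exceptional (`exists_framePole_mem_ae_poleCircle_not_mem`). At this point at least two
classes fail to have density zero, so neither has density one anywhere on the circle. Hence the
circle is split, up to a null set, between the density-one sets of the two remaining classes.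
Rotation by `θ` about the point moves the circle by chordal distance one, so it must exchange the
two sets.

No such exchange exists. If `c` is irrational, rotation by `2 * θ` is ergodic and preserves either
set, which is then null or conull. If `c = p / q` with `p` even, then `q` is odd and `q` rotations
by `θ` are the identity, yet they exchange the sets an odd number of times. -/

/-! ### Coordinates in an orthonormal frame. -/

/-- Euclidean space of dimension three. -/
abbrev Space3 : Type := EuclideanSpace ℝ (Fin 3)

/-- An orthonormal frame of Euclidean three-space. -/
abbrev Frame3 : Type := OrthonormalBasis (Fin 3) ℝ Space3

/-- The point with given coordinates in an orthonormal frame. -/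
noncomputable def framePoint (b : Frame3) (x y z : ℝ) : Space3 :=
  x • b 0 + y • b 1 + z • b 2

theorem inner_frame (b : Frame3) (i j : Fin 3) : inner ℝ (b i) (b j) = if i = j then (1 : ℝ) else 0 :=
  orthonormal_iff_ite.1 b.orthonormal i j

theorem inner_framePoint_zero (b : Frame3) (x y z : ℝ) : inner ℝ (b 0) (framePoint b x y z) = x := by
  simp only [framePoint, inner_add_right, inner_smul_right, inner_frame]; simp

theorem inner_framePoint_one (b : Frame3) (x y z : ℝ) : inner ℝ (b 1) (framePoint b x y z) = y := by
  simp only [framePoint, inner_add_right, inner_smul_right, inner_frame]; simp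

theorem inner_framePoint_two (b : Frame3) (x y z : ℝ) : inner ℝ (b 2) (framePoint b x y z) = z := by
  simp only [framePoint, inner_add_right, inner_smul_right, inner_frame]; simp

theorem framePoint_coordinates (b : Frame3) (a : Space3) :
    framePoint b (inner ℝ (b 0) a) (inner ℝ (b 1) a) (inner ℝ (b 2) a) = a := by
  conv_rhs => rw [← b.sum_repr' a]
  rw [Fin.sum_univ_three, framePoint]

theorem norm_sq_eq_sum_coordinates (b : Frame3) (a : Space3) :
    ‖a‖ ^ 2 = (inner ℝ (b 0) a : ℝ) ^ 2 + (inner ℝ (b 1) a : ℝ) ^ 2 + (inner ℝ (b 2) a : ℝ) ^ 2 := by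
  rw [← b.sum_sq_norm_inner_right a, Fin.sum_univ_three]; simp only [Real.norm_eq_abs, sq_abs]

theorem norm_sq_framePoint (b : Frame3) (x y z : ℝ) :
    ‖framePoint b x y z‖ ^ 2 = x ^ 2 + y ^ 2 + z ^ 2 := by
  rw [norm_sq_eq_sum_coordinates b, inner_framePoint_zero, inner_framePoint_one,
    inner_framePoint_two]

theorem inner_framePoint_framePoint (b : Frame3) (x y z x' y' z' : ℝ) :
    inner ℝ (framePoint b x y z) (framePoint b x' y' z') = x * x' + y * y' + z * z' := by
  conv_lhs => rw [framePoint]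
  simp only [inner_add_left, real_inner_smul_left, inner_framePoint_zero, inner_framePoint_one,
    inner_framePoint_two]

theorem framePoint_sub (b : Frame3) (x y z x' y' z' : ℝ) :
    framePoint b x y z - framePoint b x' y' z' = framePoint b (x - x') (y - y') (z - z') := by
  simp only [framePoint, sub_smul]; abel

theorem dist_sq_framePoint (b : Frame3) (x y z x' y' z' : ℝ) :
    dist (framePoint b x y z) (framePoint b x' y' z') ^ 2
      = (x - x') ^ 2 + (y - y') ^ 2 + (z - z') ^ 2 := by
  rw [dist_eq_norm, framePoint_sub, norm_sq_framePoint]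

theorem framePoint_mem_sphere (b : Frame3) {r x y z : ℝ} (hr : 0 ≤ r)
    (h : x ^ 2 + y ^ 2 + z ^ 2 = r ^ 2) : framePoint b x y z ∈ sphere (0 : Space3) r := by
  rw [mem_sphere_zero_iff_norm, ← abs_of_nonneg hr, ← abs_of_nonneg (norm_nonneg _),
    ← sq_eq_sq_iff_abs_eq_abs, norm_sq_framePoint, h]

theorem exists_frame_of_inner (v : Fin 3 → Space3) (s : Set (Fin 3))
    (h : ∀ i ∈ s, ∀ j ∈ s, inner ℝ (v i) (v j) = if i = j then (1 : ℝ) else 0) :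
    ∃ b : Frame3, ∀ i ∈ s, b i = v i := by
  classical
  refine Orthonormal.exists_orthonormalBasis_extension_of_card_eq (by simp) ?_
  rw [orthonormal_iff_ite]
  rintro ⟨i, hi⟩ ⟨j, hj⟩
  simpa using h i hi j hj

theorem exists_frame_two {r : ℝ} (hr : 0 < r) (x : TwoSphere r) :
    ∃ b : Frame3, (x : Space3) = framePoint b 0 0 r := by
  obtain ⟨b, hb⟩ := exists_frame_of_inner (fun _ => r⁻¹ • (x : Space3)) {2} (by
    rintro i rfl j rfl
    have hx : ‖(x : Space3)‖ = r := by simp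
    rw [if_pos rfl, real_inner_smul_left, real_inner_smul_right, real_inner_self_eq_norm_sq, hx]
    field_simp)
  refine ⟨b, ?_⟩
  rw [framePoint, hb 2 rfl, smul_inv_smul₀ hr.ne']
  simp

theorem norm_framePoint_le (b : Frame3) (x y z : ℝ) :
    ‖framePoint b x y z‖ ≤ |x| + |y| + |z| := by
  unfold framePoint
  refine (norm_add_le _ _).trans (add_le_add ((norm_add_le _ _).trans (add_le_add ?_ ?_)) ?_) <;>
  simp [norm_smul]

/-! ### Area of small balls on the sphere. -/

theorem sphereMeasure_eq_image {r : ℝ} (s : Set (TwoSphere r)) :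
    sphereMeasure r s = Measure.hausdorffMeasure 2 ((↑) '' s : Set Space3) :=
  (isometry_subtype_coe.hausdorffMeasure_image (Or.inl zero_le_two) s).symm

theorem frameProjection_lipschitz (b : Frame3) :
    LipschitzWith 1 (fun a : Space3 => ((inner ℝ (b 0) a, inner ℝ (b 1) a) : ℝ × ℝ)) := by
  have h : ∀ i, LipschitzWith 1 (fun a : Space3 => (inner ℝ (b i) a : ℝ)) := fun i =>
    LipschitzWith.of_dist_le_mul fun a a' => by
      rw [Real.dist_eq, ← inner_sub_right, dist_eq_norm]
      simpa using abs_real_inner_le_norm (b i) (a - a')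
  simpa using (h 0).prodMk (h 1)

/-- Projection to a coordinate plane is 1-Lipschitz, and the 2-dimensional Hausdorff measure of `ℝ ×
ℝ` with its sup metric is exactly `volume`. This serves for lower bounds on area and for projecting
null sets. -/
theorem volume_frameProjection_le {r : ℝ} (b : Frame3) (s : Set (TwoSphere r)) :
    volume ((fun x : TwoSphere r => ((inner ℝ (b 0) (x : Space3), inner ℝ (b 1) (x : Space3)) : ℝ × ℝ))
      '' s) ≤ sphereMeasure r s := by
  have h := (frameProjection_lipschitz b).hausdorffMeasure_image_le zero_le_two
    ((↑) '' s : Set Space3)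
  rw [image_image, hausdorffMeasure_prod_real, ← sphereMeasure_eq_image] at h
  simpa using h

/-- Near a pole the sphere is the graph of this height function. It does not depend on the frame, so
one `K` and one `ρ` serve every point of the sphere. -/
theorem exists_lipschitz_height {r : ℝ} (hr : 0 < r) :
    ∃ K : ℝ≥0, ∃ ρ : ℝ, 0 < ρ ∧ ρ ≤ r / 2 ∧
      LipschitzOnWith K (fun p : ℝ × ℝ => √(r ^ 2 - p.1 ^ 2 - p.2 ^ 2)) (closedBall 0 ρ) := by
  have hc : ContDiffAt ℝ 1 (fun p : ℝ × ℝ => √(r ^ 2 - p.1 ^ 2 - p.2 ^ 2)) 0 := by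
    refine ContDiffAt.sqrt (by fun_prop) ?_
    simp [hr.ne']
  obtain ⟨K, t, ht, hK⟩ := hc.exists_lipschitzOnWith
  obtain ⟨ρ, hρ, hρt⟩ := Metric.nhds_basis_closedBall.mem_iff.1 ht
  refine ⟨K, min ρ (r / 2), by positivity, min_le_right _ _, hK.mono ?_⟩
  exact (closedBall_subset_closedBall (min_le_left _ _)).trans hρt

theorem volume_closedBall_prod (ε : ℝ) :
    volume (closedBall (0 : ℝ × ℝ) ε) = ENNReal.ofReal (2 * ε) * ENNReal.ofReal (2 * ε) := by
  rw [show (0 : ℝ × ℝ) = (0, 0) from rfl, ← closedBall_prod_same, Measure.volume_eq_prod,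
    Measure.prod_prod, Real.volume_closedBall]

/-- Small balls of the sphere have measure comparable to the square of the radius. -/
theorem exists_sphereMeasure_closedBall_bounds {r : ℝ} (hr : 0 < r) :
    ∃ c C δ : ℝ, 0 < c ∧ 0 < C ∧ 0 < δ ∧ ∀ x : TwoSphere r, ∀ ε, 0 ≤ ε → ε ≤ δ →
      ENNReal.ofReal (c * ε ^ 2) ≤ sphereMeasure r (closedBall x ε) ∧
      sphereMeasure r (closedBall x ε) ≤ ENNReal.ofReal (C * ε ^ 2) := by
  obtain ⟨K, ρ, hρ, hρr, hK⟩ := exists_lipschitz_height hr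
  set L : ℝ≥0 := K + 2 with hL
  have hLpos : (0 : ℝ) < L := by positivity
  have hL1 : (1 : ℝ) ≤ L := by rw [hL]; push_cast; linarith [K.2]
  refine ⟨4 / L ^ 2, 4 * L ^ 2, ρ, by positivity, by positivity, hρ, fun x ε hε hερ => ?_⟩
  obtain ⟨b, hb⟩ := exists_frame_two hr x
  set q : ℝ × ℝ → ℝ := fun p => √(r ^ 2 - p.1 ^ 2 - p.2 ^ 2) with hq
  have hsq : ∀ p ∈ closedBall (0 : ℝ × ℝ) ρ, p.1 ^ 2 + p.2 ^ 2 + q p ^ 2 = r ^ 2 := by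
    intro p hp
    rw [mem_closedBall_zero_iff, Prod.norm_def, max_le_iff, Real.norm_eq_abs, Real.norm_eq_abs] at hp
    have h1 : p.1 ^ 2 ≤ (r / 2) ^ 2 := by
      rw [← sq_abs]; exact pow_le_pow_left₀ (abs_nonneg _) (hp.1.trans hρr) 2
    have h2 : p.2 ^ 2 ≤ (r / 2) ^ 2 := by
      rw [← sq_abs]; exact pow_le_pow_left₀ (abs_nonneg _) (hp.2.trans hρr) 2
    rw [hq, Real.sq_sqrt (by nlinarith)]; ring
  set f : ℝ × ℝ → Space3 := fun p => framePoint b p.1 p.2 (q p) with hf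
  have hfx : f 0 = x := by simp [hf, hb, hq, Real.sqrt_sq hr.le]
  have hfL : LipschitzOnWith L f (closedBall 0 ρ) := by
    refine LipschitzOnWith.of_dist_le_mul fun p hp p' hp' => ?_
    have h1 := hK.dist_le_mul p hp p' hp'
    rw [hf, dist_eq_norm, framePoint_sub]
    refine (norm_framePoint_le _ _ _ _).trans ?_
    rw [Real.dist_eq] at h1
    have h2 : |p.1 - p'.1| ≤ dist p p' := by rw [← Real.dist_eq]; exact le_max_left _ _
    have h3 : |p.2 - p'.2| ≤ dist p p' := by rw [← Real.dist_eq]; exact le_max_right _ _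
    rw [hL]; push_cast; simp only [hq] at *; linarith
  have hvol : ∀ t : ℝ, 0 ≤ t → volume (closedBall (0 : ℝ × ℝ) t) = ENNReal.ofReal (4 * t ^ 2) := by
    intro t ht
    rw [volume_closedBall_prod, ← ENNReal.ofReal_mul (by positivity)]; congr 1; ring
  constructor
  · have hle : ε / L ≤ ρ := (div_le_self hε hL1).trans hερ
    calc ENNReal.ofReal (4 / L ^ 2 * ε ^ 2) = volume (closedBall (0 : ℝ × ℝ) (ε / L)) := by
          rw [hvol _ (by positivity)]; congr 1; field_simp
      _ ≤ volume ((fun x : TwoSphere r => ((inner ℝ (b 0) (x : Space3), inner ℝ (b 1) (x : Space3)) :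
            ℝ × ℝ)) '' closedBall x ε) := by
          refine measure_mono fun p hp => ?_
          have hpρ := closedBall_subset_closedBall hle hp
          refine ⟨⟨f p, framePoint_mem_sphere b hr.le (hsq p hpρ)⟩, ?_, ?_⟩
          · rw [mem_closedBall, Subtype.dist_eq, ← hfx]
            refine (hfL.dist_le_mul p hpρ 0 (mem_closedBall_self hρ.le)).trans ?_
            rw [mem_closedBall, le_div_iff₀ hLpos] at hp
            linarith
          · simp [hf, inner_framePoint_zero, inner_framePoint_one]
      _ ≤ _ := volume_frameProjection_le b _
  · calc sphereMeasure r (closedBall x ε)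
        = Measure.hausdorffMeasure 2 ((↑) '' closedBall x ε : Set Space3) :=
          sphereMeasure_eq_image _
      _ ≤ Measure.hausdorffMeasure 2 (f '' closedBall 0 ε) := by
          refine measure_mono ?_
          rintro _ ⟨y, hy, rfl⟩
          have hyn : ‖(y : Space3)‖ = r := by simp
          have hns := norm_sq_eq_sum_coordinates b (y : Space3)
          rw [hyn] at hns
          have hd : dist (y : Space3) x ≤ ε := hy
          have hds : dist (y : Space3) x ^ 2 ≤ ε ^ 2 := pow_le_pow_left₀ dist_nonneg hd 2
          have hcoord := framePoint_coordinates b (y : Space3)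
          set y0 : ℝ := inner ℝ (b 0) (y : Space3)
          set y1 : ℝ := inner ℝ (b 1) (y : Space3)
          set y2 : ℝ := inner ℝ (b 2) (y : Space3)
          rw [hb, ← hcoord, dist_sq_framePoint] at hds
          -- Since `ε ≤ ρ ≤ r / 2`, the ball stays in the upper hemisphere, so the height is the
          -- nonnegative root.
          have hy2 : 0 ≤ y2 := by nlinarith [sq_nonneg (y0 - 0)]
          refine ⟨(y0, y1), ?_, ?_⟩
          · rw [mem_closedBall_zero_iff, Prod.norm_def, max_le_iff]
            exact ⟨abs_le_of_sq_le_sq (by nlinarith [sq_nonneg (y1 - 0), sq_nonneg (y2 - r)]) hε,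
              abs_le_of_sq_le_sq (by nlinarith [sq_nonneg (y0 - 0), sq_nonneg (y2 - r)]) hε⟩
          · have : q (y0, y1) = y2 := by
              rw [hq]; dsimp only
              rw [show r ^ 2 - y0 ^ 2 - y1 ^ 2 = y2 ^ 2 by linarith, Real.sqrt_sq hy2]
            simp only [hf, this, hcoord]
      _ ≤ (L : ℝ≥0∞) ^ (2 : ℝ) * Measure.hausdorffMeasure 2 (closedBall (0 : ℝ × ℝ) ε) :=
          (hfL.mono (closedBall_subset_closedBall hερ)).hausdorffMeasure_image_le zero_le_two
      _ = ENNReal.ofReal (4 * L ^ 2 * ε ^ 2) := by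
          rw [hausdorffMeasure_prod_real, hvol _ hε, ENNReal.rpow_ofNat,
            ← ENNReal.ofReal_coe_nnreal, ← ENNReal.ofReal_pow L.coe_nonneg, ← ENNReal.ofReal_mul (by positivity)]
          congr 1; ring

theorem isUnifLocDoublingMeasure_sphereMeasure {r : ℝ} (hr : 0 < r) :
    IsUnifLocDoublingMeasure (sphereMeasure r) := by
  obtain ⟨c, C, δ, hc, hC, hδ, h⟩ := exists_sphereMeasure_closedBall_bounds hr
  refine ⟨⟨(4 * C / c).toNNReal, ?_⟩⟩
  filter_upwards [Ioo_mem_nhdsGT (half_pos hδ)] with ε hε x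
  have hε0 := hε.1.le
  refine ((h x (2 * ε) (by linarith) (by linarith [hε.2])).2).trans ?_
  refine le_trans ?_ (mul_le_mul_right (h x ε hε0 (by linarith [hε.2])).1 _)
  rw [← ENNReal.ofReal, ← ENNReal.ofReal_mul (by positivity)]
  refine ENNReal.ofReal_le_ofReal (le_of_eq ?_)
  field_simp
  ring

theorem isLocallyFiniteMeasure_sphereMeasure {r : ℝ} (hr : 0 < r) :
    IsLocallyFiniteMeasure (sphereMeasure r) := by
  obtain ⟨c, C, δ, hc, hC, hδ, h⟩ := exists_sphereMeasure_closedBall_bounds hr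
  exact ⟨fun x => ⟨closedBall x δ, closedBall_mem_nhds x hδ,
    ((h x δ hδ.le le_rfl).2).trans_lt ENNReal.ofReal_lt_top⟩⟩

/-! ### Sparse points and density. -/

/-- The points around which `A` has area at most `η * ε ^ 2` in all balls of radius `ε < δ`. -/
def sparsePoints {r : ℝ} (A : Set (TwoSphere r)) (η δ : ℝ) : Set (TwoSphere r) :=
  {x | ∀ ε, 0 < ε → ε < δ → sphereMeasure r (ball x ε ∩ A) ≤ ENNReal.ofReal (η * ε ^ 2)}

/-- The points at which `A` has density zero. -/
def zeroDensityPoints {r : ℝ} (A : Set (TwoSphere r)) : Set (TwoSphere r) :=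
  {x | ∀ η, 0 < η → ∃ δ, 0 < δ ∧ x ∈ sparsePoints A η δ}

variable {r : ℝ} {A B : Set (TwoSphere r)}

theorem sparsePoints_anti_radius {η δ δ' : ℝ} (h : δ' ≤ δ) :
    sparsePoints A η δ ⊆ sparsePoints A η δ' :=
  fun _ hx ε h0 h1 => hx ε h0 (h1.trans_le h)

theorem sparsePoints_anti_set {η δ : ℝ} (h : A ⊆ B) : sparsePoints B η δ ⊆ sparsePoints A η δ :=
  fun _ hx ε h0 h1 => (measure_mono (inter_subset_inter_right _ h)).trans (hx ε h0 h1)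

theorem sparsePoints_union {η η' δ : ℝ} (hη : 0 ≤ η) (hη' : 0 ≤ η') :
    sparsePoints A η δ ∩ sparsePoints B η' δ ⊆ sparsePoints (A ∪ B) (η + η') δ := by
  intro x hx ε h0 h1
  rw [inter_union_distrib_left, add_mul, ENNReal.ofReal_add (by positivity) (by positivity)]
  exact (measure_union_le _ _).trans (add_le_add (hx.1 ε h0 h1) (hx.2 ε h0 h1))

theorem zeroDensityPoints_anti (h : A ⊆ B) : zeroDensityPoints B ⊆ zeroDensityPoints A :=
  fun _ hx η hη => let ⟨δ, hδ, h'⟩ := hx η hη; ⟨δ, hδ, sparsePoints_anti_set h h'⟩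

theorem zeroDensityPoints_union :
    zeroDensityPoints A ∩ zeroDensityPoints B ⊆ zeroDensityPoints (A ∪ B) := by
  intro x hx η hη
  obtain ⟨δ, hδ, h⟩ := hx.1 (η / 2) (half_pos hη)
  obtain ⟨δ', hδ', h'⟩ := hx.2 (η / 2) (half_pos hη)
  refine ⟨min δ δ', lt_min hδ hδ', ?_⟩
  rw [← add_halves η]
  exact sparsePoints_union (half_pos hη).le (half_pos hη).le
    ⟨sparsePoints_anti_radius (min_le_left _ _) h, sparsePoints_anti_radius (min_le_right _ _) h'⟩

theorem zeroDensityPoints_iUnion_finset {ι : Type*} (s : Finset ι) (A : ι → Set (TwoSphere r))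
    {x : TwoSphere r} (hx : ∀ i ∈ s, x ∈ zeroDensityPoints (A i)) :
    x ∈ zeroDensityPoints (⋃ i ∈ s, A i) := by
  classical
  induction s using Finset.induction_on with
  | empty => intro η hη; exact ⟨1, one_pos, fun ε h0 h1 => by simp⟩
  | insert i s hi ih =>
    rw [Finset.set_biUnion_insert]
    exact zeroDensityPoints_union ⟨hx i (Finset.mem_insert_self _ _),
      ih fun j hj => hx j (Finset.mem_insert_of_mem hj)⟩

/-- The whole sphere is nowhere sparse. -/
theorem exists_sparsePoints_univ_eq_empty (hr : 0 < r) :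
    ∃ c : ℝ, 0 < c ∧ ∀ η δ, η < c → 0 < δ → sparsePoints (univ : Set (TwoSphere r)) η δ = ∅ := by
  obtain ⟨c, C, δ₀, hc, hC, hδ₀, h⟩ := exists_sphereMeasure_closedBall_bounds hr
  -- The factor `1 / 4` pays for passing to the closed ball of half the radius inside the open one.
  refine ⟨c / 4, by positivity, fun η δ hη hδ => eq_empty_of_forall_notMem fun x hx => ?_⟩
  set ε := min δ δ₀ / 2 with hε
  have hm : 0 < min δ δ₀ := lt_min hδ hδ₀
  have hε0 : 0 < ε := by positivity
  have h1 := hx ε hε0 (by linarith [min_le_left δ δ₀])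
  have h2 := (h x (ε / 2) (by positivity) (by linarith [min_le_right δ δ₀])).1
  rw [inter_univ] at h1
  have h3 := (h2.trans (measure_mono (closedBall_subset_ball (half_lt_self hε0)))).trans h1
  rw [ENNReal.ofReal_le_ofReal_iff'] at h3
  have : 0 < ε ^ 2 := by positivity
  rcases h3 with h3 | h3 <;> nlinarith

theorem not_mem_zeroDensityPoints_compl (hr : 0 < r) {x : TwoSphere r}
    (h : x ∈ zeroDensityPoints A) (h' : x ∈ zeroDensityPoints Aᶜ) : False := by
  obtain ⟨c, hc, hc'⟩ := exists_sparsePoints_univ_eq_empty hr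
  have hu := zeroDensityPoints_union ⟨h, h'⟩
  rw [union_compl_self] at hu
  obtain ⟨δ, hδ, hx⟩ := hu (c / 2) (half_pos hc)
  rw [hc' _ _ (half_lt_self hc) hδ] at hx
  exact hx

/-- An open ball is the increasing union of slightly smaller concentric balls, and each of these
lies in the ball of radius `ε` about any sparse point close enough to the center. Continuity of
measure along increasing unions holds for arbitrary sets, so `A` may be arbitrary. -/
theorem isClosed_sparsePoints (A : Set (TwoSphere r)) (η δ : ℝ) :
    IsClosed (sparsePoints A η δ) := by
  refine isClosed_of_closure_subset fun x hx ε h0 h1 => ?_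
  have hmono : ∀ n : ℕ, ball x (ε - ε / (n + 1)) ⊆ ball x ε := fun n =>
    ball_subset_ball (sub_le_self _ (by positivity))
  have hU : ball x ε ∩ A = ⋃ n : ℕ, ball x (ε - ε / (n + 1)) ∩ A := by
    refine Subset.antisymm (fun y hy => ?_) (iUnion_subset fun n =>
      inter_subset_inter_left _ (hmono n))
    have hlt : 0 < ε - dist y x := sub_pos.2 hy.1
    obtain ⟨n, hn⟩ := exists_nat_gt (ε / (ε - dist y x))
    refine mem_iUnion.2 ⟨n, ?_, hy.2⟩
    rw [mem_ball]
    have : ε / (n + 1) < ε - dist y x := by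
      rw [div_lt_iff₀ (by positivity)]
      rw [div_lt_iff₀ hlt] at hn
      nlinarith
    linarith
  have hdir : Monotone fun n : ℕ => ball x (ε - ε / (n + 1)) ∩ A := by
    intro m n hmn
    refine inter_subset_inter_left _ (ball_subset_ball ?_)
    gcongr
  rw [hU, hdir.measure_iUnion]
  refine iSup_le fun n => ?_
  obtain ⟨y, hy, hxy⟩ := Metric.mem_closure_iff.1 hx (ε / (n + 1)) (by positivity)
  refine (measure_mono (inter_subset_inter_left _ ?_)).trans (hy ε h0 h1)
  exact ball_subset_ball' (by linarith)

theorem zeroDensityPoints_eq_iInter_iUnion (A : Set (TwoSphere r)) :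
    zeroDensityPoints A = ⋂ m : ℕ, ⋃ n : ℕ, sparsePoints A (1 / (m + 1)) (1 / (n + 1)) := by
  ext x
  simp only [mem_iInter, mem_iUnion]
  refine ⟨fun hx m => ?_, fun hx η hη => ?_⟩
  · obtain ⟨δ, hδ, h⟩ := hx (1 / (m + 1)) (by positivity)
    obtain ⟨n, hn⟩ := exists_nat_one_div_lt hδ
    exact ⟨n, sparsePoints_anti_radius hn.le h⟩
  · obtain ⟨m, hm⟩ := exists_nat_one_div_lt hη
    obtain ⟨n, hn⟩ := hx m
    exact ⟨1 / (n + 1), by positivity, fun ε h0 h1 => (hn ε h0 h1).trans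
      (ENNReal.ofReal_le_ofReal (by gcongr))⟩

/-- Borel, not merely null, measurability matters: these sets are later pulled back along a circle,
which is itself a null set of the sphere. -/
theorem measurableSet_zeroDensityPoints (A : Set (TwoSphere r)) :
    MeasurableSet (zeroDensityPoints A) := by
  rw [zeroDensityPoints_eq_iInter_iUnion]
  exact MeasurableSet.iInter fun m => MeasurableSet.iUnion fun n =>
    (isClosed_sparsePoints _ _ _).measurableSet

/-- **Lebesgue's density theorem** on the sphere. -/
theorem ae_mem_zeroDensityPoints_compl (hr : 0 < r) (hA : NullMeasurableSet A (sphereMeasure r)) :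
    ∀ᵐ x ∂sphereMeasure r, x ∈ A → x ∈ zeroDensityPoints Aᶜ := by
  have := isUnifLocDoublingMeasure_sphereMeasure hr
  have := isLocallyFiniteMeasure_sphereMeasure hr
  obtain ⟨c, C, δ₀, hc, hC, hδ₀, hb⟩ := exists_sphereMeasure_closedBall_bounds hr
  obtain ⟨t, ht, hAt⟩ := hA.compl
  filter_upwards [(IsUnifLocDoublingMeasure.vitaliFamily (sphereMeasure r)
    1).ae_tendsto_measure_inter_div_of_measurableSet ht, hAt.mem_iff] with x hx hxt hxA η hη
  -- Here `t` is a measurable set almost equal to `Aᶜ`; its density at almost every point of `A` is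
  -- zero.
  have hx0 : t.indicator (1 : TwoSphere r → ℝ≥0∞) x = 0 :=
    indicator_of_notMem (fun h => hxt.2 h hxA) _
  rw [hx0] at hx
  have hlim := hx.comp (IsUnifLocDoublingMeasure.tendsto_closedBall_filterAt (sphereMeasure r)
    (K := 1) (x := x) (l := 𝓝[>] (0 : ℝ)) (fun _ => x) id tendsto_id
    (by filter_upwards [self_mem_nhdsWithin] with ε hε
        exact mem_closedBall_self (by simpa using (mem_Ioi.1 hε).le)))
  have hev := hlim.eventually (gt_mem_nhds (ENNReal.ofReal_pos.2 (div_pos hη hC)))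
  obtain ⟨δ, hδ, hsub⟩ := mem_nhdsGT_iff_exists_Ioo_subset.1 hev
  refine ⟨min δ δ₀, lt_min hδ hδ₀, fun ε h0 h1 => ?_⟩
  have h2 : sphereMeasure r (t ∩ closedBall x ε) / sphereMeasure r (closedBall x ε)
      < ENNReal.ofReal (η / C) := hsub ⟨h0, h1.trans_le (min_le_left _ _)⟩
  have hbx := hb x ε h0.le (h1.le.trans (min_le_right _ _))
  have hpos : sphereMeasure r (closedBall x ε) ≠ 0 :=
    ((ENNReal.ofReal_pos.2 (by positivity)).trans_le hbx.1).ne'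
  have hfin : sphereMeasure r (closedBall x ε) ≠ ⊤ :=
    (hbx.2.trans_lt ENNReal.ofReal_lt_top).ne
  rw [ENNReal.div_lt_iff (Or.inl hpos) (Or.inl hfin)] at h2
  calc sphereMeasure r (ball x ε ∩ Aᶜ) = sphereMeasure r (ball x ε ∩ t) :=
        measure_congr ((ae_eq_refl _).inter hAt)
    _ ≤ sphereMeasure r (t ∩ closedBall x ε) := by
        rw [inter_comm]; exact measure_mono (inter_subset_inter_right _ ball_subset_closedBall)
    _ ≤ ENNReal.ofReal (η / C) * ENNReal.ofReal (C * ε ^ 2) :=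
        h2.le.trans (mul_le_mul_right hbx.2 _)
    _ = ENNReal.ofReal (η * ε ^ 2) := by
        rw [← ENNReal.ofReal_mul (by positivity)]; congr 1; field_simp

/-! ### A local map moving every point by distance one. -/

/-- The cosine of the angle of the rotation about an axis that moves by chordal distance one the
points of the sphere of radius `r` at height `h` along that axis. -/
noncomputable def twistCos (r h : ℝ) : ℝ := 1 - 1 / (2 * (r ^ 2 - h ^ 2))

/-- Rotation about the third axis of the frame `b` by the angle whose cosine is given by `twistCos`
at the height of the point; the sign `σ` is the sense of the rotation. -/
noncomputable def twist (b : Frame3) (r σ : ℝ) (a : Space3) : Space3 :=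
  framePoint b
    (twistCos r (inner ℝ (b 2) a) * inner ℝ (b 0) a
      - σ * √(1 - twistCos r (inner ℝ (b 2) a) ^ 2) * inner ℝ (b 1) a)
    (σ * √(1 - twistCos r (inner ℝ (b 2) a) ^ 2) * inner ℝ (b 0) a
      + twistCos r (inner ℝ (b 2) a) * inner ℝ (b 1) a)
    (inner ℝ (b 2) a)

theorem one_sub_twistCos_zero_sq {r : ℝ} (hr : r ≠ 0) :
    1 - twistCos r 0 ^ 2 = (4 * r ^ 2 - 1) / (4 * (r ^ 2) ^ 2) := by
  unfold twistCos; field_simp; ring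

theorem one_sub_twistCos_zero_sq_pos {r : ℝ} (hr : 1 / 4 < r ^ 2) : 0 < 1 - twistCos r 0 ^ 2 := by
  have hr0 : r ≠ 0 := by rintro rfl; norm_num at hr
  rw [one_sub_twistCos_zero_sq hr0]
  exact div_pos (by linarith) (by positivity)

theorem contDiffAt_inner_frame (b : Frame3) (i : Fin 3) (a : Space3) :
    ContDiffAt ℝ 1 (fun a : Space3 => (inner ℝ (b i) a : ℝ)) a :=
  (innerSL ℝ (b i)).contDiff.contDiffAt

theorem contDiffAt_twistCos_inner (b : Frame3) {r : ℝ} (hr : 1 / 4 < r ^ 2) {a : Space3}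
    (ha : inner ℝ (b 2) a = (0 : ℝ)) :
    ContDiffAt ℝ 1 (fun a : Space3 => twistCos r (inner ℝ (b 2) a)) a := by
  have hr0 : r ≠ 0 := by rintro rfl; norm_num at hr
  have h2 := contDiffAt_inner_frame b 2 a
  unfold twistCos
  refine contDiffAt_const.sub (contDiffAt_const.div (by fun_prop) ?_)
  rw [ha]; simpa using hr0

theorem contDiffAt_twist (b : Frame3) {r : ℝ} (hr : 1 / 4 < r ^ 2) (σ : ℝ) {a : Space3}
    (ha : inner ℝ (b 2) a = (0 : ℝ)) : ContDiffAt ℝ 1 (twist b r σ) a := by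
  have hC := contDiffAt_twistCos_inner b hr ha
  have hS : ContDiffAt ℝ 1 (fun a : Space3 => √(1 - twistCos r (inner ℝ (b 2) a) ^ 2)) a := by
    refine ContDiffAt.sqrt (contDiffAt_const.sub (hC.pow 2)) ?_
    rw [ha]; exact (one_sub_twistCos_zero_sq_pos hr).ne'
  unfold twist framePoint
  have h0 := contDiffAt_inner_frame b 0 a
  have h1 := contDiffAt_inner_frame b 1 a
  have h2 := contDiffAt_inner_frame b 2 a
  fun_prop

/-- The twist preserves height, so the opposite twist turns back by the same angle. -/
theorem twist_neg_twist (b : Frame3) {r : ℝ} {a : Space3}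
    (ha : 0 ≤ 1 - twistCos r (inner ℝ (b 2) a) ^ 2) : twist b r (-1) (twist b r 1 a) = a := by
  conv_rhs => rw [← framePoint_coordinates b a]
  have hs := Real.sq_sqrt ha
  unfold twist
  simp only [inner_framePoint_zero, inner_framePoint_one, inner_framePoint_two]
  congr 1 <;> ring_nf <;> rw [hs] <;> ring

theorem norm_twist (b : Frame3) {r : ℝ} {a : Space3}
    (ha : 0 ≤ 1 - twistCos r (inner ℝ (b 2) a) ^ 2) : ‖twist b r 1 a‖ = ‖a‖ := by
  have hs := Real.sq_sqrt ha
  rw [← sq_eq_sq₀ (norm_nonneg _) (norm_nonneg _), norm_sq_eq_sum_coordinates b a]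
  unfold twist
  rw [norm_sq_framePoint]
  ring_nf
  rw [hs]
  ring

theorem dist_twist (b : Frame3) {r : ℝ} {a : Space3} (har : ‖a‖ = r)
    (hlt : (inner ℝ (b 2) a : ℝ) ^ 2 < r ^ 2)
    (ha : 0 ≤ 1 - twistCos r (inner ℝ (b 2) a) ^ 2) : dist a (twist b r 1 a) = 1 := by
  have hs := Real.sq_sqrt ha
  have hn := norm_sq_eq_sum_coordinates b a
  rw [har] at hn
  have hc : 2 * (1 - twistCos r (inner ℝ (b 2) a)) * (r ^ 2 - (inner ℝ (b 2) a : ℝ) ^ 2) = 1 := by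
    have : r ^ 2 - (inner ℝ (b 2) a : ℝ) ^ 2 ≠ 0 := (sub_pos.2 hlt).ne'
    unfold twistCos; field_simp; ring
  rw [← sq_eq_sq₀ dist_nonneg zero_le_one]
  conv_lhs => rw [← framePoint_coordinates b a]
  unfold twist
  simp only [inner_framePoint_zero, inner_framePoint_one, inner_framePoint_two]
  rw [dist_sq_framePoint]
  set x : ℝ := inner ℝ (b 0) a
  set y : ℝ := inner ℝ (b 1) a
  set z : ℝ := inner ℝ (b 2) a
  set C := twistCos r z
  set S := √(1 - C ^ 2)
  linear_combination (x ^ 2 + y ^ 2) * hs + hc - 2 * (1 - C) * hn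

/-- Gram–Schmidt applied to `x` and `y` puts both on the equator of the frame, where the twist is
smooth and carries `x` to `y`. -/
theorem exists_frame_of_dist_eq_one {r : ℝ} (hr0 : 0 < r) (hr : 1 / 4 < r ^ 2) {x y : TwoSphere r}
    (h : dist x y = 1) : ∃ b : Frame3, (x : Space3) = framePoint b r 0 0 ∧
      (y : Space3) = framePoint b (r * twistCos r 0) (r * √(1 - twistCos r 0 ^ 2)) 0 := by
  have hx : ‖(x : Space3)‖ = r := by simp
  have hy : ‖(y : Space3)‖ = r := by simp
  have hpos := one_sub_twistCos_zero_sq_pos hr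
  set c := twistCos r 0 with hc
  set s := √(1 - c ^ 2) with hs
  have hs0 : 0 < s := Real.sqrt_pos.2 hpos
  have hs2 : s ^ 2 = 1 - c ^ 2 := Real.sq_sqrt hpos.le
  have hrc : r ^ 2 * c = r ^ 2 - 1 / 2 := by rw [hc]; unfold twistCos; field_simp; ring
  have hxx : inner ℝ (x : Space3) x = r ^ 2 := by rw [real_inner_self_eq_norm_sq, hx]
  have hyy : inner ℝ (y : Space3) y = r ^ 2 := by rw [real_inner_self_eq_norm_sq, hy]
  have hxy : inner ℝ (x : Space3) y = r ^ 2 * c := by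
    have h1 := norm_sub_sq_real (x : Space3) y
    rw [← dist_eq_norm, ← Subtype.dist_eq, h, hx, hy] at h1
    linarith
  have hyx : inner ℝ (y : Space3) x = r ^ 2 * c := by rw [real_inner_comm, hxy]
  obtain ⟨b, hb⟩ := exists_frame_of_inner
    ![r⁻¹ • (x : Space3), (r * s)⁻¹ • ((y : Space3) - c • (x : Space3)), 0] {0, 1} (by
    rintro i (rfl | rfl) j (rfl | rfl) <;>
    simp only [Matrix.cons_val_zero, Matrix.cons_val_one, real_inner_smul_left,
      real_inner_smul_right, inner_sub_left, inner_sub_right, hxx, hyy, hxy, hyx]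
    · rw [if_pos trivial]; field_simp
    · rw [if_neg (by decide)]; ring
    · rw [if_neg (by decide)]; ring
    · rw [if_pos trivial]
      field_simp
      linear_combination -hs2)
  have hb0 := hb 0 (by simp)
  have hb1 := hb 1 (by simp)
  simp only [Matrix.cons_val_zero, Matrix.cons_val_one] at hb0 hb1
  refine ⟨b, ?_, ?_⟩
  · simp [framePoint, hb0, smul_smul, hr0.ne']
  · rw [framePoint, hb0, hb1, smul_smul, smul_smul, mul_inv_cancel₀ (by positivity),
      mul_right_comm, mul_inv_cancel₀ hr0.ne']
    simp

/-- If `A` contains no pair of points at distance one and has density one at `y`, then it has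
density zero at all points at distance one from `y`. -/
theorem mem_zeroDensityPoints_of_dist_eq_one {r : ℝ} (hr0 : 0 < r) (hr : 1 / 4 < r ^ 2)
    {A : Set (TwoSphere r)} (hA : ∀ a ∈ A, ∀ a' ∈ A, dist a a' ≠ 1) {x y : TwoSphere r}
    (hxy : dist x y = 1) (hy : y ∈ zeroDensityPoints Aᶜ) : x ∈ zeroDensityPoints A := by
  obtain ⟨b, hbx, hby⟩ := exists_frame_of_dist_eq_one hr0 hr hxy
  have hx2 : inner ℝ (b 2) (x : Space3) = (0 : ℝ) := by rw [hbx, inner_framePoint_two]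
  have hy2 : inner ℝ (b 2) (y : Space3) = (0 : ℝ) := by rw [hby, inner_framePoint_two]
  have hTx : twist b r 1 x = y := by
    unfold twist
    rw [hx2, hbx, hby, inner_framePoint_zero, inner_framePoint_one]
    congr 1 <;> ring
  have hcT := contDiffAt_twist b hr 1 hx2
  obtain ⟨K, U, hU, hK⟩ := hcT.exists_lipschitzOnWith
  obtain ⟨K', V, hV, hK'⟩ := (contDiffAt_twist b hr (-1) hy2).exists_lipschitzOnWith
  have hTV : twist b r 1 ⁻¹' V ∈ 𝓝 (x : Space3) := by
    refine hcT.continuousAt.preimage_mem_nhds ?_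
    rwa [hTx]
  have hheight : ∀ᶠ a in 𝓝 (x : Space3), (inner ℝ (b 2) a : ℝ) ^ 2 < r ^ 2 ∧
      0 < 1 - twistCos r (inner ℝ (b 2) a) ^ 2 := by
    have hcont := (contDiffAt_inner_frame b 2 x).continuousAt
    have hC := (contDiffAt_twistCos_inner b hr hx2).continuousAt
    refine ((hcont.pow 2).eventually_lt continuousAt_const ?_).and
      (continuousAt_const.eventually_lt (continuousAt_const.sub (hC.pow 2)) ?_)
    · rw [Pi.pow_apply, hx2, zero_pow two_ne_zero]; positivity
    · rw [hx2]; exact one_sub_twistCos_zero_sq_pos hr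
  obtain ⟨ρ, hρ, hball⟩ := Metric.eventually_nhds_iff_ball.1
    (hheight.and (Filter.Eventually.and hU hTV))
  intro η hη
  set L : ℝ := K + 1 with hL
  set L' : ℝ := K' + 1 with hL'
  have hL0 : 0 < L := by positivity
  have hL'0 : 0 < L' := by positivity
  obtain ⟨δ, hδ, hsp⟩ := hy (η / (L' ^ 2 * L ^ 2)) (by positivity)
  refine ⟨min ρ (δ / L), lt_min hρ (by positivity), fun ε h0 h1 => ?_⟩
  have hερ : ε < ρ := h1.trans_le (min_le_left _ _)
  have hεδ : L * ε < δ := by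
    have := h1.trans_le (min_le_right _ _)
    rw [lt_div_iff₀ hL0] at this; linarith
  set S : Set Space3 := (↑) '' (ball x ε ∩ A) with hS
  have hSball : ∀ a ∈ S, a ∈ ball (x : Space3) ρ := by
    rintro _ ⟨a, ha, rfl⟩
    exact (mem_ball.1 ha.1).trans hερ
  -- Points of `A` near `x` are moved by distance one, hence out of `A`, and land near `y`, where
  -- `Aᶜ` is sparse.
  have hsub : twist b r 1 '' S ⊆ ((↑) '' (ball y (L * ε) ∩ Aᶜ) : Set Space3) := by
    rintro _ ⟨_, ⟨a, ha, rfl⟩, rfl⟩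
    have hab := hball a ((mem_ball.1 ha.1).trans hερ)
    have har : ‖(a : Space3)‖ = r := by simp
    refine ⟨⟨twist b r 1 a, ?_⟩, ⟨?_, fun hmem => ?_⟩, rfl⟩
    · rw [mem_sphere_zero_iff_norm, norm_twist b hab.1.2.le, har]
    · rw [mem_ball, Subtype.dist_eq, ← hTx]
      refine (hK.dist_le_mul _ hab.2.1 _ (mem_of_mem_nhds hU)).trans_lt ?_
      have h2 : dist (a : Space3) x < ε := ha.1
      have h3 : (K : ℝ) * dist (a : Space3) x ≤ K * ε := by gcongr
      rw [hL]; linarith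
    · exact hA a ha.2 _ hmem (dist_twist b har hab.1.1 hab.1.2.le)
  have hback : S = twist b r (-1) '' (twist b r 1 '' S) := by
    rw [image_image]
    refine ((image_congr fun a ha => ?_).trans (image_id' S)).symm
    exact twist_neg_twist b (hball a (hSball a ha)).1.2.le
  have hTSV : twist b r 1 '' S ⊆ V := by
    rintro _ ⟨a, ha, rfl⟩
    exact (hball a (hSball a ha)).2.2
  calc sphereMeasure r (ball x ε ∩ A) = Measure.hausdorffMeasure 2 S := sphereMeasure_eq_image _
    _ ≤ (K' : ℝ≥0∞) ^ (2 : ℝ) * Measure.hausdorffMeasure 2 (twist b r 1 '' S) := by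
        conv_lhs => rw [hback]
        exact (hK'.mono hTSV).hausdorffMeasure_image_le zero_le_two
    _ ≤ ENNReal.ofReal (L' ^ 2) * ENNReal.ofReal (η / (L' ^ 2 * L ^ 2) * (L * ε) ^ 2) := by
        refine mul_le_mul' ?_ ?_
        · rw [ENNReal.rpow_ofNat, ← ENNReal.ofReal_coe_nnreal, ← ENNReal.ofReal_pow K'.coe_nonneg]
          refine ENNReal.ofReal_le_ofReal (pow_le_pow_left₀ K'.coe_nonneg ?_ 2)
          rw [hL']; linarith
        · refine (measure_mono hsub).trans ?_
          rw [← sphereMeasure_eq_image]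
          exact hsp _ (by positivity) hεδ
    _ = ENNReal.ofReal (η * ε ^ 2) := by
        rw [← ENNReal.ofReal_mul (by positivity)]; congr 1; field_simp

/-! ### Existence of a point where no class has density one. -/

theorem inner_sphere_eq (x y : TwoSphere r) :
    inner ℝ (x : Space3) (y : Space3) = r ^ 2 - dist x y ^ 2 / 2 := by
  have hx : ‖(x : Space3)‖ = r := by simp
  have hy : ‖(y : Space3)‖ = r := by simp
  have h1 := norm_sub_sq_real (x : Space3) y
  rw [← dist_eq_norm, ← Subtype.dist_eq, hx, hy] at h1
  linarith

theorem normalize_mem_sphere (hr : 0 < r) {u : Space3} (hu : u ≠ 0) :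
    (r / ‖u‖) • u ∈ sphere (0 : Space3) r := by
  have : ‖u‖ ≠ 0 := norm_ne_zero_iff.2 hu
  rw [mem_sphere_zero_iff_norm, norm_smul, Real.norm_of_nonneg (by positivity)]
  field_simp

/-- Move from `z` along the chord towards `w` and project radially to the sphere. The scaling factor
is at least one and, as `dist w z ≤ r`, the inner product with `w` is positive, so projecting only
brings the point closer to `w`. -/
theorem mem_closure_ball_dist_sphere (hr : 0 < r) {w z : TwoSphere r} (h0 : 0 < dist w z)
    (h1 : dist w z ≤ r) : z ∈ closure (ball w (dist w z)) := by
  have hw : ‖(w : Space3)‖ = r := by simp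
  have hz : ‖(z : Space3)‖ = r := by simp
  have hz0 : (z : Space3) ≠ 0 := norm_ne_zero_iff.1 (by rw [hz]; exact hr.ne')
  have hwz := inner_sphere_eq w z
  set u : ℝ → Space3 := fun t => t • (w : Space3) + (1 - t) • (z : Space3) with hu
  have hcont : ContinuousAt (fun t => (r / ‖u t‖) • u t) 0 := by
    have hcu : ContinuousAt u 0 := by fun_prop
    refine (continuousAt_const.div hcu.norm ?_).smul hcu
    simpa [hu] using hr.ne'
  have hval : (r / ‖u 0‖) • u 0 = z := by simp [hu, hr.ne']
  rw [Metric.mem_closure_iff]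
  intro ε hε
  have hev := hcont.tendsto.eventually (Metric.ball_mem_nhds _ hε)
  obtain ⟨δ, hδ, hδt⟩ := Metric.eventually_nhds_iff.1 hev
  set t := min (δ / 2) (1 / 2) with ht
  have ht0 : 0 < t := by positivity
  have ht1 : t ≤ 1 / 2 := min_le_right _ _
  have hnear := hδt (y := t) (by
    rw [Real.dist_eq, sub_zero, abs_of_pos ht0]; linarith [min_le_left (δ / 2) (1 / 2 : ℝ)])
  rw [hval] at hnear
  have huw : inner ℝ (u t) (w : Space3) = r ^ 2 - (1 - t) * (dist w z ^ 2 / 2) := by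
    simp only [hu, inner_add_left, real_inner_smul_left, real_inner_self_eq_norm_sq, hw]
    rw [real_inner_comm, hwz]; ring
  have hd2 : dist w z ^ 2 ≤ r ^ 2 := pow_le_pow_left₀ h0.le h1 2
  have hd0 : 0 < dist w z ^ 2 := by positivity
  have hpos : 0 < inner ℝ (u t) (w : Space3) := by rw [huw]; nlinarith
  have hune : u t ≠ 0 := by rintro h; rw [h, inner_zero_left] at hpos; exact hpos.ne' rfl
  have hun : 0 < ‖u t‖ := norm_pos_iff.2 hune
  have hule : ‖u t‖ ≤ r := by
    refine (norm_add_le _ _).trans ?_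
    rw [norm_smul, norm_smul, hw, hz, Real.norm_of_nonneg ht0.le,
      Real.norm_of_nonneg (by linarith)]
    linarith
  refine ⟨⟨(r / ‖u t‖) • u t, normalize_mem_sphere hr hune⟩, ?_, ?_⟩
  · have h2 := inner_sphere_eq ⟨(r / ‖u t‖) • u t, normalize_mem_sphere hr hune⟩ w
    simp only [real_inner_smul_left] at h2
    have h3 : inner ℝ (u t) (w : Space3) ≤ r / ‖u t‖ * inner ℝ (u t) (w : Space3) :=
      le_mul_of_one_le_left hpos.le ((one_le_div hun).2 hule)
    rw [mem_ball]
    refine lt_of_pow_lt_pow_left₀ 2 h0.le ?_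
    rw [huw] at h3 h2
    nlinarith
  · rw [dist_comm, Subtype.dist_eq]; exact hnear

/-- The radial projection of the chord's midpoint is within `3 / 4` of the distance from both
endpoints. -/
theorem exists_ball_subset_inter_sphere (hr : 0 < r) {w z : TwoSphere r} (h0 : 0 < dist w z)
    (h1 : dist w z ≤ r) :
    ∃ m, ball m (dist w z / 4) ⊆ ball w (dist w z) ∩ ball z (dist w z) := by
  have hw : ‖(w : Space3)‖ = r := by simp
  have hz : ‖(z : Space3)‖ = r := by simp
  have hwz := inner_sphere_eq w z
  have hd2 : dist w z ^ 2 ≤ r ^ 2 := pow_le_pow_left₀ h0.le h1 2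
  set u : Space3 := (1 / 2 : ℝ) • ((w : Space3) + z) with hu
  have huw : inner ℝ u (w : Space3) = r ^ 2 - dist w z ^ 2 / 4 := by
    simp only [hu, inner_add_left, real_inner_smul_left, real_inner_self_eq_norm_sq, hw]
    rw [real_inner_comm, hwz]; ring
  have huz : inner ℝ u (z : Space3) = r ^ 2 - dist w z ^ 2 / 4 := by
    simp only [hu, inner_add_left, real_inner_smul_left, real_inner_self_eq_norm_sq, hz]
    rw [hwz]; ring
  have huu : ‖u‖ ^ 2 = r ^ 2 - dist w z ^ 2 / 4 := by
    rw [← real_inner_self_eq_norm_sq]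
    conv_lhs => rw [hu, inner_smul_right, inner_add_right, ← hu, huw, huz]
    ring
  have hun : 0 < ‖u‖ := by
    refine lt_of_le_of_ne (norm_nonneg _) fun h => ?_
    rw [← h] at huu; nlinarith
  have hune : u ≠ 0 := norm_pos_iff.1 hun
  have hule : ‖u‖ ≤ r := by
    refine le_of_sq_le_sq ?_ hr.le
    nlinarith [sq_nonneg (dist w z)]
  set m : TwoSphere r := ⟨(r / ‖u‖) • u, normalize_mem_sphere hr hune⟩ with hm
  have key : ∀ y : TwoSphere r, inner ℝ u (y : Space3) = r ^ 2 - dist w z ^ 2 / 4 →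
      dist m y ≤ 3 / 4 * dist w z := by
    intro y hy
    have h2 := inner_sphere_eq m y
    simp only [hm, real_inner_smul_left] at h2
    rw [hy, ← huu, ← hm] at h2
    have h3 : r / ‖u‖ * ‖u‖ ^ 2 = r * ‖u‖ := by field_simp
    rw [h3] at h2
    refine le_of_sq_le_sq ?_ (by positivity)
    nlinarith [mul_nonneg (norm_nonneg u) (sub_nonneg.2 hule)]
  refine ⟨m, subset_inter (ball_subset_ball' ?_) (ball_subset_ball' ?_)⟩
  · linarith [key w huw]
  · linarith [key z huz]

theorem exists_eq_univ_of_iUnion_eq_univ {X ι : Type*} [TopologicalSpace X] [PreconnectedSpace X]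
    [Nonempty X] {O : ι → Set X} (hO : ∀ i, IsOpen (O i))
    (hdisj : ∀ i j x, x ∈ O i → x ∈ O j → i = j) (hU : ⋃ i, O i = univ) : ∃ i, O i = univ := by
  obtain ⟨x⟩ := ‹Nonempty X›
  obtain ⟨i, hi⟩ := mem_iUnion.1 (hU ▸ mem_univ x)
  have hcompl : (O i)ᶜ = ⋃ j ∈ {j | j ≠ i}, O j := by
    ext y
    simp only [mem_compl_iff, mem_iUnion, mem_ofPred_eq, exists_prop]
    refine ⟨fun hy => ?_, ?_⟩
    · obtain ⟨j, hj⟩ := mem_iUnion.1 (hU ▸ mem_univ y)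
      exact ⟨j, fun h => hy (h ▸ hj), hj⟩
    · rintro ⟨j, hji, hj⟩ hyi
      exact hji (hdisj j i y hj hyi)
  have hclopen : IsClopen (O i) :=
    ⟨⟨hcompl ▸ isOpen_biUnion fun j _ => hO j⟩, hO i⟩
  exact ⟨i, (isClopen_iff.1 hclopen).resolve_left fun h => by rw [h] at hi; exact hi⟩

theorem exists_relative_ball_subset_of_closed_cover {X ι : Type*} [MetricSpace X] [CompleteSpace X]
    [Countable ι] {F : Set X} (hF : IsClosed F) (hne : F.Nonempty) {K : ι → Set X}
    (hK : ∀ i, IsClosed (K i)) (hcover : ∀ x, ∃ i, x ∈ K i) :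
    ∃ i, ∃ z ∈ F, ∃ ρ > 0, ∀ x ∈ F, dist x z < ρ → x ∈ K i := by
  have : Nonempty F := hne.to_subtype
  have : CompleteSpace F := hF.completeSpace_coe
  obtain ⟨i, ⟨z, hzF⟩, hz⟩ := nonempty_interior_of_iUnion_of_closed
    (f := fun i => (Subtype.val ⁻¹' K i : Set F)) (fun i => (hK i).preimage continuous_subtype_val)
    (eq_univ_of_forall fun x => mem_iUnion.2 (hcover x))
  obtain ⟨ρ, hρ, hball⟩ := Metric.mem_nhds_iff.1 (mem_interior_iff_mem_nhds.1 hz)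
  exact ⟨i, z, hzF, ρ, hρ, fun x hx hd => @hball ⟨x, hx⟩ hd⟩

/-- A partition of the sphere into measurable sets, none of which has density one everywhere, leaves
a point at which no set of the partition has density one. -/
theorem exists_forall_not_mem_zeroDensityPoints_compl (hr : 0 < r) {ι : Type*} [Countable ι]
    (A : ι → Set (TwoSphere r)) (hA : ∀ i, NullMeasurableSet (A i) (sphereMeasure r))
    (hcover : ∀ x, ∃ i, x ∈ A i) (hdisj : ∀ i j, i ≠ j → A i ⊆ (A j)ᶜ)
    (hproper : ∀ i, zeroDensityPoints (A i)ᶜ ≠ univ) :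
    ∃ x, ∀ i, x ∉ zeroDensityPoints (A i)ᶜ := by
  by_contra! hall
  set D : ι → Set (TwoSphere r) := fun i => zeroDensityPoints (A i)ᶜ with hD
  set O : ι → Set (TwoSphere r) := fun i => interior (D i) with hO
  have hDdisj : ∀ i j x, x ∈ D i → x ∈ D j → i = j := by
    intro i j x hi hj
    by_contra hij
    exact not_mem_zeroDensityPoints_compl hr (zeroDensityPoints_anti (hdisj i j hij) hj) hi
  have hOD : ∀ i, O i ⊆ D i := fun i => interior_subset
  have hOopen : ∀ i, IsOpen (O i) := fun i => isOpen_interior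
  have hae : ∀ᵐ x ∂sphereMeasure r, ∀ i, x ∈ D i → x ∈ A i := by
    filter_upwards [ae_all_iff.2 fun i => ae_mem_zeroDensityPoints_compl hr (hA i)] with x hx i hi
    obtain ⟨j, hj⟩ := hcover x
    rwa [hDdisj i j x hi (hx j hj)]
  obtain ⟨c, C, δ₀, hc, hC, hδ₀, hbounds⟩ := exists_sphereMeasure_closedBall_bounds hr
  obtain ⟨c', hc', hempty⟩ := exists_sparsePoints_univ_eq_empty hr
  -- The bound `c' / 4` prevents a set and its complement from both being `η`-sparse at a point; `c
  -- / 128` is below the `c / 64` that a ball of radius `dist w y / 8` provides at the end.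
  set η := min (c / 128) (c' / 4) with hη
  have hη0 : 0 < η := by positivity
  set K : ι × ℕ → Set (TwoSphere r) := fun p => sparsePoints (A p.1)ᶜ η (1 / (p.2 + 1)) with hK
  have hKD : ∀ p, K p ⊆ D p.1 := by
    intro p x hx
    obtain ⟨j, hj⟩ := hall x
    by_cases hpj : p.1 = j
    · rwa [hpj]
    · obtain ⟨δ, hδ, hs⟩ := zeroDensityPoints_anti (hdisj p.1 j hpj) hj η hη0
      have hm : 0 < min δ (1 / ((p.2 : ℝ) + 1)) := lt_min hδ (by positivity)
      have hu := sparsePoints_union hη0.le hη0.le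
        ⟨sparsePoints_anti_radius (min_le_left _ _) hs, sparsePoints_anti_radius (min_le_right _ _) hx⟩
      rw [union_compl_self, hempty _ _ (by linarith [min_le_right (c / 128) (c' / 4)]) hm] at hu
      exact hu.elim
  have hKcover : ∀ x, ∃ p, x ∈ K p := by
    intro x
    obtain ⟨i, hi⟩ := hall x
    obtain ⟨δ, hδ, hs⟩ := hi η hη0
    obtain ⟨n, hn⟩ := exists_nat_one_div_lt hδ
    exact ⟨(i, n), sparsePoints_anti_radius hn.le hs⟩
  -- Baire is applied to the common boundary `Bd`, nonempty by connectedness: near some `z` in it,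
  -- all of `Bd` lies in a single `K (i, n)`.
  set Bd : Set (TwoSphere r) := (⋃ i, O i)ᶜ with hBd
  have hBdclosed : IsClosed Bd := (isOpen_iUnion hOopen).isClosed_compl
  have hBdne : Bd.Nonempty := by
    by_contra hne
    have hU : ⋃ i, O i = univ := by
      rw [not_nonempty_iff_eq_empty, hBd, compl_empty_iff] at hne; exact hne
    have : PreconnectedSpace (TwoSphere r) := Subtype.preconnectedSpace
      (isPreconnected_sphere (by rw [← Module.finrank_eq_rank]; simp) _ _)
    have : Nonempty (TwoSphere r) := (NormedSpace.sphere_nonempty.2 hr.le).to_subtype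
    obtain ⟨i, hi⟩ := exists_eq_univ_of_iUnion_eq_univ hOopen
      (fun i j x hi hj => hDdisj i j x (hOD i hi) (hOD j hj)) hU
    exact hproper i (eq_univ_of_univ_subset (hi ▸ hOD i))
  obtain ⟨⟨i, n⟩, z, hzBd, ρ₀, hρ₀, hzK⟩ := exists_relative_ball_subset_of_closed_cover hBdclosed hBdne
    (K := K) (fun p => isClosed_sparsePoints _ _ _) hKcover
  set ρ₁ := min (min ρ₀ (1 / ((n : ℝ) + 1))) (min r δ₀) with hρ₁
  have hρ₁pos : 0 < ρ₁ := lt_min (lt_min hρ₀ (by positivity)) (lt_min hr hδ₀)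
  have hzO : z ∉ interior (D i) := fun h => hzBd (mem_iUnion.2 ⟨i, h⟩)
  obtain ⟨w, hwz, hwD⟩ : ∃ w, dist w z < ρ₁ / 2 ∧ w ∉ D i := by
    by_contra! hcon
    exact hzO (mem_interior_iff_mem_nhds.2 (Metric.mem_nhds_iff.2
      ⟨ρ₁ / 2, half_pos hρ₁pos, fun w hw => hcon w hw⟩))
  have hle0 : ρ₁ ≤ ρ₀ := (min_le_left _ _).trans (min_le_left _ _)
  have hlen : ρ₁ ≤ 1 / ((n : ℝ) + 1) := (min_le_left _ _).trans (min_le_right _ _)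
  have hler : ρ₁ ≤ r := (min_le_right _ _).trans (min_le_left _ _)
  have hleδ : ρ₁ ≤ δ₀ := (min_le_right _ _).trans (min_le_right _ _)
  obtain ⟨j, hwj⟩ : ∃ j, w ∈ O j := by
    by_contra hcon
    exact hwD (hKD (i, n) (hzK w (fun h => hcon (mem_iUnion.1 h)) (by linarith)))
  have hij : j ≠ i := fun h => hwD (h ▸ hOD j hwj)
  have hzOj : z ∈ (O j)ᶜ := fun h => hzBd (mem_iUnion.2 ⟨j, h⟩)
  -- The ball about `w` grows inside `O j` until it touches the complement at `y`. Then `y` lies in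
  -- `Bd`, so `(A i)ᶜ` is sparse at `y`, yet a fixed proportion of the ball about `y` is almost
  -- filled by `A j`.
  obtain ⟨y, hy, hyd⟩ := (hOopen j).isClosed_compl.exists_infDist_eq_dist ⟨z, hzOj⟩ w
  have hρle : dist w y < ρ₁ / 2 := by
    rw [← hyd]; exact (Metric.infDist_le_dist_of_mem hzOj).trans_lt hwz
  have hρpos : 0 < dist w y := dist_pos.2 fun h => hy (h ▸ hwj)
  have hball : ball w (dist w y) ⊆ O j := by
    rw [← hyd]
    exact fun x hx => not_not.1 fun hxO =>
      (Metric.infDist_le_dist_of_mem (x := w) (s := (O j)ᶜ) hxO).not_gt (by rwa [dist_comm])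
  have hyBd : y ∈ Bd := by
    intro hyU
    obtain ⟨k, hk⟩ := mem_iUnion.1 hyU
    obtain ⟨x, hxk, hxb⟩ := mem_closure_iff.1
      (mem_closure_ball_dist_sphere hr hρpos (by linarith)) _ (hOopen k) hk
    have hkj := hDdisj k j x (hOD k hxk) (hOD j (hball hxb))
    exact hy (hkj ▸ hk)
  have hyK := hzK y hyBd (by
    have := dist_triangle y w z
    rw [dist_comm y w] at this; linarith) (dist w y) hρpos (by simp only; linarith)
  obtain ⟨m, hm⟩ := exists_ball_subset_inter_sphere hr hρpos (by linarith)
  have hcb : closedBall m (dist w y / 8) ⊆ ball m (dist w y / 4) :=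
    closedBall_subset_ball (by linarith)
  have h1 := (hbounds m (dist w y / 8) (by positivity) (by linarith)).1
  have h2 : sphereMeasure r (closedBall m (dist w y / 8))
      ≤ sphereMeasure r (ball y (dist w y) ∩ (A i)ᶜ) := by
    refine measure_mono_ae ?_
    filter_upwards [hae] with x hx hxm
    have hx' := hm (hcb hxm)
    exact ⟨hx'.2, hdisj j i hij (hx j (hOD j (hball hx'.1)))⟩
  have h3 := (h1.trans h2).trans hyK
  have hsq : 0 < dist w y ^ 2 := by positivity
  rw [ENNReal.ofReal_le_ofReal_iff'] at h3
  rcases h3 with h3 | h3 <;> nlinarith [min_le_left (c / 128) (c' / 4)]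

/-! ### Null sets and circles of chordal radius one. -/

/-- Near each point of `S` the map has a Lipschitz local inverse, which carries null sets to null
sets. -/
theorem volume_inter_preimage_eq_zero {f : ℝ × ℝ → ℝ × ℝ} {S N : Set (ℝ × ℝ)} (hN : volume N = 0)
    (hf : ∀ p ∈ S, ∃ f' : (ℝ × ℝ) ≃L[ℝ] ℝ × ℝ, HasStrictFDerivAt f (f' : ℝ × ℝ →L[ℝ] ℝ × ℝ) p) :
    volume (S ∩ f ⁻¹' N) = 0 := by
  refine measure_null_of_locally_null _ fun p hp => ?_
  obtain ⟨f', hf'⟩ := hf p hp.1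
  obtain ⟨K, U, hU, hK⟩ := hf'.to_localInverse.exists_lipschitzOnWith
  have hev := hf'.eventually_left_inverse.and (hf'.continuousAt.preimage_mem_nhds hU)
  refine ⟨{x | hf'.localInverse f f' p (f x) = x ∧ f x ∈ U} ∩ (S ∩ f ⁻¹' N),
    inter_mem (mem_nhdsWithin_of_mem_nhds hev) self_mem_nhdsWithin, ?_⟩
  refine measure_mono_null (t := hf'.localInverse f f' p '' (U ∩ N))
    (fun x hx => ⟨f x, ⟨hx.1.2, hx.2.2⟩, hx.1.1⟩) ?_
  have h := (hK.mono (inter_subset_left (t := N))).hausdorffMeasure_image_le zero_le_two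
  rw [hausdorffMeasure_prod_real, measure_mono_null inter_subset_right hN, mul_zero] at h
  exact nonpos_iff_eq_zero.1 h

/-- The rotation of a plane curve has invertible derivative where the distance of the curve from the
origin has nonzero derivative. -/
theorem exists_hasStrictFDerivAt_rotated_curve {P Q : ℝ → ℝ} {P' Q' : ℝ} {p : ℝ × ℝ}
    (hP : HasStrictDerivAt P P' p.2) (hQ : HasStrictDerivAt Q Q' p.2)
    (hne : P p.2 * P' + Q p.2 * Q' ≠ 0) :
    ∃ f' : (ℝ × ℝ) ≃L[ℝ] ℝ × ℝ, HasStrictFDerivAt (fun q : ℝ × ℝ =>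
      (P q.2 * Real.cos q.1 - Q q.2 * Real.sin q.1, P q.2 * Real.sin q.1 + Q q.2 * Real.cos q.1))
      (f' : ℝ × ℝ →L[ℝ] ℝ × ℝ) p := by
  have hc := (Real.hasStrictDerivAt_cos p.1).comp_hasStrictFDerivAt p
    (hasStrictFDerivAt_fst (𝕜 := ℝ) (E := ℝ) (F := ℝ) (p := p))
  have hs := (Real.hasStrictDerivAt_sin p.1).comp_hasStrictFDerivAt p
    (hasStrictFDerivAt_fst (𝕜 := ℝ) (E := ℝ) (F := ℝ) (p := p))
  have hP2 := hP.comp_hasStrictFDerivAt p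
    (hasStrictFDerivAt_snd (𝕜 := ℝ) (E := ℝ) (F := ℝ) (p := p))
  have hQ2 := hQ.comp_hasStrictFDerivAt p
    (hasStrictFDerivAt_snd (𝕜 := ℝ) (E := ℝ) (F := ℝ) (p := p))
  have hf := ((hP2.mul hc).sub (hQ2.mul hs)).prodMk ((hP2.mul hs).add (hQ2.mul hc))
  set L : ℝ × ℝ →L[ℝ] ℝ × ℝ := _ with hL
  change HasStrictFDerivAt _ L p at hf
  have hinj : Function.Injective (L : ℝ × ℝ →ₗ[ℝ] ℝ × ℝ) := by
    rw [injective_iff_map_eq_zero]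
    intro v hv
    have h1 := congrArg Prod.fst hv
    have h2 := congrArg Prod.snd hv
    simp [hL] at h1 h2
    have hcs := Real.sin_sq_add_cos_sq p.1
    -- Cramer's rule: up to sign, the Jacobian determinant is `P * P' + Q * Q'`.
    have e1 : (P p.2 * P' + Q p.2 * Q') * v.1 = 0 := by
      linear_combination (-(P' * Real.sin p.1 + Q' * Real.cos p.1)) * h1
        + (P' * Real.cos p.1 - Q' * Real.sin p.1) * h2 - (P p.2 * P' + Q p.2 * Q') * v.1 * hcs
    have e2 : (P p.2 * P' + Q p.2 * Q') * v.2 = 0 := by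
      linear_combination (P p.2 * Real.cos p.1 - Q p.2 * Real.sin p.1) * h1
        + (P p.2 * Real.sin p.1 + Q p.2 * Real.cos p.1) * h2
        - (P p.2 * P' + Q p.2 * Q') * v.2 * hcs
    exact Prod.ext ((mul_eq_zero.1 e1).resolve_left hne) ((mul_eq_zero.1 e2).resolve_left hne)
  refine ⟨(LinearEquiv.ofInjectiveEndo _ hinj).toContinuousLinearEquiv, ?_⟩
  convert hf using 1
  · rfl
  · exact ContinuousLinearMap.ext fun v => rfl

theorem countable_cos_eq (k : ℝ) : {t : ℝ | Real.cos t = k}.Countable := by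
  by_cases h : ∃ x, Real.cos x = k
  · obtain ⟨x, rfl⟩ := h
    have : {t : ℝ | Real.cos t = Real.cos x} ⊆
        (range fun n : ℤ => 2 * n * Real.pi + x) ∪ range fun n : ℤ => 2 * n * Real.pi - x := by
      intro t ht
      obtain ⟨n, hn | hn⟩ := Real.cos_eq_cos_iff.1 (Eq.symm ht)
      · exact Or.inl ⟨n, hn.symm⟩
      · exact Or.inr ⟨n, hn.symm⟩
    exact ((countable_range _).union (countable_range _)).mono this
  · push Not at h
    convert countable_empty
    exact eq_empty_of_forall_notMem h

theorem countable_sin_eq_zero : {t : ℝ | Real.sin t = 0}.Countable := by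
  refine (countable_range fun n : ℤ => n * Real.pi).mono fun t ht => ?_
  exact Real.sin_eq_zero_iff.1 ht

/-- The sine of the angular radius of a circle of chordal radius one. -/
noncomputable def twistSin (r : ℝ) : ℝ := √(1 - twistCos r 0 ^ 2)

theorem twistSin_pos (hr : 1 / 4 < r ^ 2) : 0 < twistSin r :=
  Real.sqrt_pos.2 (one_sub_twistCos_zero_sq_pos hr)

theorem twistSin_sq (hr : 1 / 4 < r ^ 2) : twistSin r ^ 2 = 1 - twistCos r 0 ^ 2 :=
  Real.sq_sqrt (one_sub_twistCos_zero_sq_pos hr).le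

theorem two_mul_sq_mul_one_sub_twistCos_zero (hr : 1 / 4 < r ^ 2) :
    2 * r ^ 2 * (1 - twistCos r 0) = 1 := by
  have : r ≠ 0 := by rintro rfl; norm_num at hr
  unfold twistCos; field_simp; ring

/-- The point of the sphere in the direction of the third vector of the frame. -/
noncomputable def framePole (hr : 0 < r) (b : Frame3) : TwoSphere r :=
  ⟨framePoint b 0 0 r, framePoint_mem_sphere b hr.le (by ring)⟩

/-- The circle at distance one around the pole of a frame. -/
noncomputable def poleCircle (hr : 0 < r) (hr' : 1 / 4 < r ^ 2) (b : Frame3) (t : ℝ) :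
    TwoSphere r :=
  ⟨framePoint b (r * twistSin r * Real.cos t) (r * twistSin r * Real.sin t) (r * twistCos r 0),
    framePoint_mem_sphere b hr.le (by
      linear_combination r ^ 2 * twistSin r ^ 2 * Real.sin_sq_add_cos_sq t + r ^ 2 * twistSin_sq hr')⟩

theorem dist_framePole_poleCircle (hr : 0 < r) (hr' : 1 / 4 < r ^ 2) (b : Frame3) (t : ℝ) :
    dist (framePole hr b) (poleCircle hr hr' b t) = 1 := by
  rw [← sq_eq_sq₀ dist_nonneg zero_le_one, Subtype.dist_eq]
  simp only [framePole, poleCircle, dist_sq_framePoint]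
  linear_combination r ^ 2 * twistSin r ^ 2 * Real.sin_sq_add_cos_sq t + r ^ 2 * twistSin_sq hr'
    + two_mul_sq_mul_one_sub_twistCos_zero hr'

theorem dist_poleCircle_add (hr : 0 < r) (hr' : 1 / 4 < r ^ 2) (b : Frame3) {θ : ℝ}
    (hθ : 2 * r ^ 2 * twistSin r ^ 2 * (1 - Real.cos θ) = 1) (t : ℝ) :
    dist (poleCircle hr hr' b t) (poleCircle hr hr' b (t + θ)) = 1 := by
  rw [← sq_eq_sq₀ dist_nonneg zero_le_one, Subtype.dist_eq]
  simp only [poleCircle, dist_sq_framePoint]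
  rw [Real.cos_add, Real.sin_add]
  linear_combination hθ + r ^ 2 * twistSin r ^ 2 * (Real.sin_sq_add_cos_sq θ)
    + r ^ 2 * twistSin r ^ 2 * (2 * (1 - Real.cos θ) + Real.sin θ ^ 2 + Real.cos θ ^ 2 - 1) *
      Real.sin_sq_add_cos_sq t

theorem continuous_poleCircle (hr : 0 < r) (hr' : 1 / 4 < r ^ 2) (b : Frame3) :
    Continuous (poleCircle hr hr' b) := by
  refine Continuous.subtype_mk ?_ _
  unfold framePoint
  fun_prop

theorem exists_frame_rotated (hr' : 1 / 4 < r ^ 2) (b : Frame3) (s : ℝ) : ∃ b' : Frame3,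
    b' 0 = framePoint b (twistCos r 0 * Real.cos s) (twistCos r 0 * Real.sin s) (-twistSin r) ∧
    b' 1 = framePoint b (-Real.sin s) (Real.cos s) 0 ∧
    b' 2 = framePoint b (twistSin r * Real.cos s) (twistSin r * Real.sin s) (twistCos r 0) := by
  have h1 := Real.sin_sq_add_cos_sq s
  have h2 := twistSin_sq hr'
  obtain ⟨b', hb'⟩ := exists_frame_of_inner
    ![framePoint b (twistCos r 0 * Real.cos s) (twistCos r 0 * Real.sin s) (-twistSin r),
      framePoint b (-Real.sin s) (Real.cos s) 0,
      framePoint b (twistSin r * Real.cos s) (twistSin r * Real.sin s) (twistCos r 0)] univ (by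
    rintro i - j -
    fin_cases i <;> fin_cases j <;> simp [inner_framePoint_framePoint, -inner_self_eq_norm_sq_to_K]
    · linear_combination twistCos r 0 ^ 2 * h1 + h2
    · ring
    · linear_combination twistCos r 0 * twistSin r * h1
    · ring
    · linear_combination h1
    · ring
    · linear_combination twistCos r 0 * twistSin r * h1
    · ring
    · linear_combination twistSin r ^ 2 * h1 + h2)
  exact ⟨b', hb' 0 trivial, hb' 1 trivial, hb' 2 trivial⟩

/-- For almost every point `y` of a circle of chordal radius one, almost every point of the circle
of chordal radius one about `y` avoids a given null set. -/
theorem ae_exists_frame_ae_poleCircle_not_mem (hr : 0 < r) (hr' : 1 / 4 < r ^ 2)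
    {M : Set (TwoSphere r)} (hM : sphereMeasure r M = 0) (b : Frame3) :
    ∀ᵐ s : ℝ, ∃ b' : Frame3, framePole hr b' = poleCircle hr hr' b s ∧
      ∀ᵐ t : ℝ, poleCircle hr hr' b' t ∉ M := by
  set c := twistCos r 0 with hc
  set d := twistSin r with hd
  have hd0 : 0 < d := twistSin_pos hr'
  have hdc : d ^ 2 = 1 - c ^ 2 := twistSin_sq hr'
  -- The point at angle `t` on the circle about `poleCircle hr hr' b s` projects to the curve `(P t,
  -- Q t)` rotated by `s`. Off the countable set `Z` its distance from the origin has nonzero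
  -- derivative.
  set P : ℝ → ℝ := fun t => r * d * c * (1 + Real.cos t) with hP
  set Q : ℝ → ℝ := fun t => r * d * Real.sin t with hQ
  set N := (fun x : TwoSphere r =>
    ((inner ℝ (b 0) (x : Space3), inner ℝ (b 1) (x : Space3)) : ℝ × ℝ)) '' M with hN
  have hN0 : volume N = 0 := nonpos_iff_eq_zero.1 ((volume_frameProjection_le b M).trans_eq hM)
  set Z : Set ℝ := {t | Real.sin t = 0} ∪ {t | Real.cos t = c ^ 2 / d ^ 2} with hZ
  have hZ0 : volume Z = 0 := (countable_sin_eq_zero.union (countable_cos_eq _)).measure_zero _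
  have h1 := volume_inter_preimage_eq_zero (S := {p | p.2 ∉ Z}) (f := fun q : ℝ × ℝ =>
      (P q.2 * Real.cos q.1 - Q q.2 * Real.sin q.1, P q.2 * Real.sin q.1 + Q q.2 * Real.cos q.1))
      hN0 (fun p hp => by
    have hPd : HasStrictDerivAt P (r * d * c * -Real.sin p.2) p.2 :=
      ((Real.hasStrictDerivAt_cos p.2).const_add 1).const_mul _
    have hQd : HasStrictDerivAt Q (r * d * Real.cos p.2) p.2 :=
      (Real.hasStrictDerivAt_sin p.2).const_mul _
    refine exists_hasStrictFDerivAt_rotated_curve hPd hQd ?_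
    have hp1 : Real.sin p.2 ≠ 0 := fun h => hp (Or.inl h)
    have hp2 : Real.cos p.2 * d ^ 2 - c ^ 2 ≠ 0 := fun h => hp (Or.inr (by
      rw [mem_ofPred_eq, eq_div_iff (by positivity)]; linarith))
    have : P p.2 * (r * d * c * -Real.sin p.2) + Q p.2 * (r * d * Real.cos p.2)
        = (r * d) ^ 2 * Real.sin p.2 * (Real.cos p.2 * d ^ 2 - c ^ 2) := by
      simp only [hP, hQ]
      linear_combination (-(r * d) ^ 2 * Real.sin p.2 * Real.cos p.2) * hdc
    rw [this]
    exact mul_ne_zero (mul_ne_zero (by positivity) hp1) hp2)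
  have h2 : volume {p : ℝ × ℝ | p.2 ∈ Z} = 0 := by
    have : {p : ℝ × ℝ | p.2 ∈ Z} = univ ×ˢ Z := by ext p; simp
    rw [this, Measure.volume_eq_prod, Measure.prod_prod, hZ0, mul_zero]
  have h3 : ∀ᵐ p : ℝ × ℝ, (P p.2 * Real.cos p.1 - Q p.2 * Real.sin p.1,
      P p.2 * Real.sin p.1 + Q p.2 * Real.cos p.1) ∉ N := by
    filter_upwards [measure_eq_zero_iff_ae_notMem.1 h1, measure_eq_zero_iff_ae_notMem.1 h2]
      with p hp1 hp2 hpN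
    exact hp1 ⟨hp2, hpN⟩
  rw [Measure.volume_eq_prod] at h3
  filter_upwards [Measure.ae_ae_of_ae_prod h3] with s hs
  obtain ⟨b', hb0, hb1, hb2⟩ := exists_frame_rotated hr' b s
  refine ⟨b', ?_, ?_⟩
  · refine Subtype.ext ?_
    simp only [framePole, poleCircle]
    conv_lhs => rw [framePoint, hb2]
    simp only [framePoint, smul_add, smul_smul, zero_smul, zero_add]
    simp only [mul_assoc]
  · filter_upwards [hs] with t ht htM
    refine ht ⟨_, htM, ?_⟩
    simp only [poleCircle]
    rw [framePoint, hb0, hb1, hb2]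
    simp only [inner_add_right, real_inner_smul_right, inner_framePoint_zero, inner_framePoint_one]
    ext <;> simp only [hP, hQ, ← hc, ← hd] <;> ring

/-- A nonempty null set contains a point such that almost all points at distance one from it lie
outside of the set. -/
theorem exists_framePole_mem_ae_poleCircle_not_mem (hr : 0 < r) (hr' : 1 / 4 < r ^ 2)
    {M : Set (TwoSphere r)} (hM : sphereMeasure r M = 0) (hne : M.Nonempty) :
    ∃ b : Frame3, framePole hr b ∈ M ∧ ∀ᵐ t : ℝ, poleCircle hr hr' b t ∉ M := by
  obtain ⟨x, hx⟩ := hne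
  obtain ⟨b, hb⟩ := exists_frame_two hr x
  have hbx : framePole hr b = x := Subtype.ext hb.symm
  by_cases h : ∀ᵐ t : ℝ, poleCircle hr hr' b t ∉ M
  · exact ⟨b, hbx ▸ hx, h⟩
  -- Otherwise the circle meets `M` in a non-null set of parameters, while almost every point of
  -- that circle is a good center; some point is both.
  · obtain ⟨s, hs, b', hb', hae⟩ := ((not_eventually.1 h).and_eventually
      (ae_exists_frame_ae_poleCircle_not_mem hr hr' hM b)).exists
    exact ⟨b', hb' ▸ not_not.1 hs, hae⟩

/-! ### Periodic sets exchanged with their complement by a translation. -/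

theorem ae_add_right {P : ℝ → Prop} (h : ∀ᵐ t, P t) (a : ℝ) : ∀ᵐ t, P (t + a) :=
  (measurePreserving_add_right volume a).quasiMeasurePreserving.ae h

/-- Along the orbit of almost every `t`, membership in `B` alternates at each step, but after `q`
steps, an odd number, periodicity brings it back. -/
theorem not_ae_flip_of_odd {B : Set ℝ} {θ : ℝ} {q m : ℕ} (hq : Odd q)
    (hB : ∀ t, t + 2 * Real.pi ∈ B ↔ t ∈ B) (hθ : q * θ = m * (2 * Real.pi))
    (hflip : ∀ᵐ t, (t ∈ B ↔ t + θ ∉ B)) : False := by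
  have hall : ∀ᵐ t : ℝ, ∀ n : ℕ, (t + n * θ ∈ B ↔ t + n * θ + θ ∉ B) :=
    ae_all_iff.2 fun n => ae_add_right hflip _
  obtain ⟨t, ht⟩ := hall.exists
  have hn : ∀ n : ℕ, t + n * θ ∈ B ↔ (Even n ↔ t ∈ B) := by
    intro n
    induction n with
    | zero => simp
    | succ n ih =>
      have h1 := ht n
      have h2 : t + ((n + 1 : ℕ) : ℝ) * θ = t + n * θ + θ := by push_cast; ring
      rw [h2, Nat.even_add_one]
      tauto
  have hper : ∀ k : ℕ, t + k * (2 * Real.pi) ∈ B ↔ t ∈ B := by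
    intro k
    induction k with
    | zero => simp
    | succ k ih =>
      have h2 : t + ((k + 1 : ℕ) : ℝ) * (2 * Real.pi) = t + k * (2 * Real.pi) + 2 * Real.pi := by
        push_cast; ring
      rw [h2, hB, ih]
  have h1 := hn q
  rw [hθ, hper] at h1
  have h2 : ¬ Even q := Nat.not_even_iff_odd.2 hq
  tauto

/-- Two flips cancel, so on the circle `B` is invariant under the rotation by `2 * θ`, which is
ergodic. A null or conull set cannot be exchanged with its complement. -/
theorem not_ae_flip_of_irrational {B : Set ℝ} (hBm : MeasurableSet B) {θ c : ℝ}
    (hB : ∀ t, t + 2 * Real.pi ∈ B ↔ t ∈ B) (hθ : θ = c * Real.pi) (hc : Irrational c)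
    (hflip : ∀ᵐ t, (t ∈ B ↔ t + θ ∉ B)) : False := by
  have : Fact (0 < 2 * Real.pi) := ⟨Real.two_pi_pos⟩
  let S : Set (AddCircle (2 * Real.pi)) :=
    {z | Function.Periodic.lift (f := fun t => t ∈ B) (fun t => propext (hB t)) z}
  have hSm : MeasurableSet S := measurableSet_quotient.2 hBm
  have htrans : ∀ a : AddCircle (2 * Real.pi), MeasurePreserving (· + a) volume volume :=
    fun a => measurePreserving_add_right volume a
  have hflipS : ∀ᵐ z : AddCircle (2 * Real.pi),
      (z ∈ S ↔ z + (θ : AddCircle (2 * Real.pi)) ∉ S) := by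
    have hmk := AddCircle.measurePreserving_mk (2 * Real.pi) 0
    rw [← hmk.map_eq, ae_map_iff hmk.measurable.aemeasurable]
    · filter_upwards [ae_restrict_of_ae hflip] with t ht
      exact ht
    · exact measurableSet_setOfPred.2 ((measurableSet_setOfPred.1 hSm).iff
        (measurableSet_setOfPred.1 ((htrans θ).measurable hSm)).not)
  have hflipS' := (htrans θ).quasiMeasurePreserving.ae hflipS
  have hinv : (· + ((2 * θ : ℝ) : AddCircle (2 * Real.pi))) ⁻¹' S =ᵐ[volume] S := by
    filter_upwards [hflipS, hflipS'] with z h1 h2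
    have h3 : z + ((2 * θ : ℝ) : AddCircle (2 * Real.pi)) = z + θ + θ := by
      rw [two_mul θ, AddCircle.coe_add, add_assoc]
    refine propext ?_
    change z + ((2 * θ : ℝ) : AddCircle (2 * Real.pi)) ∈ S ↔ z ∈ S
    rw [h3]
    tauto
  have herg : Ergodic (· + ((2 * θ : ℝ) : AddCircle (2 * Real.pi))) := by
    rw [AddCircle.ergodic_add_right, ← AddCircle.denseRange_zsmul_iff,
      AddCircle.denseRange_zsmul_coe_iff]
    have : 2 * θ / (2 * Real.pi) = c := by
      rw [hθ]; field_simp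
    rwa [this]
  rcases herg.quasiErgodic.ae_empty_or_univ₀ hSm.nullMeasurableSet hinv with h | h
  · have h1 : ∀ᵐ z, z ∉ S := by
      filter_upwards [h.mem_iff] with z hz
      simpa using hz
    obtain ⟨z, h2, h3, h4⟩ :=
      (hflipS.and (h1.and ((htrans θ).quasiMeasurePreserving.ae h1))).exists
    exact h3 (h2.2 h4)
  · have h1 : ∀ᵐ z, z ∈ S := by
      filter_upwards [h.mem_iff] with z hz
      simpa using hz
    obtain ⟨z, h2, h3, h4⟩ :=
      (hflipS.and (h1.and ((htrans θ).quasiMeasurePreserving.ae h1))).exists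
    exact h2.1 h3 h4

/-! ### From a four-coloring to a contradiction. -/

/-- At a point where no color class has density one, at least two color classes have positive upper
density. -/
theorem exists_two_not_mem_zeroDensityPoints {ι : Type*} [Fintype ι] [Nonempty ι]
    {A : ι → Set (TwoSphere r)} (hcover : ∀ x, ∃ i, x ∈ A i) {x : TwoSphere r}
    (hx : ∀ i, x ∉ zeroDensityPoints (A i)ᶜ) :
    ∃ i j, i ≠ j ∧ x ∉ zeroDensityPoints (A i) ∧ x ∉ zeroDensityPoints (A j) := by
  classical
  -- Choosing `i` of positive upper density whenever one exists means that a second such class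
  -- settles both claims.
  obtain ⟨i, hi⟩ : ∃ i, ∀ j, j ≠ i → x ∉ zeroDensityPoints (A j) → x ∉ zeroDensityPoints (A i) := by
    by_cases h : ∃ i, x ∉ zeroDensityPoints (A i)
    · exact h.imp fun i hi j _ _ => hi
    · exact ⟨Classical.arbitrary ι, fun j _ hj => (h ⟨j, hj⟩).elim⟩
  obtain ⟨j, hji, hj⟩ : ∃ j, j ≠ i ∧ x ∉ zeroDensityPoints (A j) := by
    by_contra! hcon
    have h1 := zeroDensityPoints_iUnion_finset (Finset.univ.erase i) A (x := x)
      fun j hj => hcon j (Finset.ne_of_mem_erase hj)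
    refine hx i (zeroDensityPoints_anti (fun y hy => ?_) h1)
    obtain ⟨k, hk⟩ := hcover y
    exact mem_biUnion (Finset.mem_coe.2 (Finset.mem_erase.2
      ⟨fun h => hy (h ▸ hk), Finset.mem_univ k⟩)) hk
  exact ⟨i, j, hji.symm, hi j hji hj, hj⟩

/-- A proper coloring of the sphere by four measurable colors yields a circle of chordal radius one
and a measurable subset of it that the rotation moving points by chordal distance one maps, up to
null sets, onto its complement. -/
theorem exists_ae_flip_of_four_coloring (hr : 0 < r) (hr' : 1 / 4 < r ^ 2) {θ : ℝ}
    (hθ : 2 * r ^ 2 * twistSin r ^ 2 * (1 - Real.cos θ) = 1) (φ : TwoSphere r → Fin 4)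
    (hφ : ∀ x y, dist x y = 1 → φ x ≠ φ y)
    (hm : ∀ i, NullMeasurableSet (φ ⁻¹' {i}) (sphereMeasure r)) :
    ∃ B : Set ℝ, MeasurableSet B ∧ (∀ t, t + 2 * Real.pi ∈ B ↔ t ∈ B) ∧
      ∀ᵐ t, (t ∈ B ↔ t + θ ∉ B) := by
  set A : Fin 4 → Set (TwoSphere r) := fun i => φ ⁻¹' {i} with hA
  have hfar : ∀ i, ∀ a ∈ A i, ∀ a' ∈ A i, dist a a' ≠ 1 := by
    intro i a ha a' ha' h
    exact hφ a a' h (ha.trans (Eq.symm ha'))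
  have hcover : ∀ x, ∃ i, x ∈ A i := fun x => ⟨φ x, rfl⟩
  have hdisj : ∀ i j, i ≠ j → A i ⊆ (A j)ᶜ := fun i j hij x hi hj => hij (hi.symm.trans hj)
  have hunit : ∀ i x y, dist x y = 1 → y ∈ zeroDensityPoints (A i)ᶜ → x ∈ zeroDensityPoints (A i) :=
    fun i x y h hy => mem_zeroDensityPoints_of_dist_eq_one hr hr' (hfar i) h hy
  have hadj : ∀ i x y, dist x y = 1 → x ∈ zeroDensityPoints (A i)ᶜ →
      y ∉ zeroDensityPoints (A i)ᶜ :=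
    fun i x y h hx hy => not_mem_zeroDensityPoints_compl hr (hunit i x y h hy) hx
  have hproper : ∀ i, zeroDensityPoints (A i)ᶜ ≠ univ := by
    intro i h
    obtain ⟨x⟩ : Nonempty (TwoSphere r) := (NormedSpace.sphere_nonempty.2 hr.le).to_subtype
    obtain ⟨b, -⟩ := exists_frame_two hr x
    exact hadj i _ _ (dist_framePole_poleCircle hr hr' b 0) (h ▸ mem_univ _) (h ▸ mem_univ _)
  have hnull : sphereMeasure r {x | ∀ i, x ∉ zeroDensityPoints (A i)ᶜ} = 0 := by
    rw [measure_eq_zero_iff_ae_notMem]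
    filter_upwards [ae_all_iff.2 fun i => ae_mem_zeroDensityPoints_compl hr (hm i)] with x hx h
    exact h (φ x) (hx (φ x) rfl)
  obtain ⟨b, hb, hae⟩ := exists_framePole_mem_ae_poleCircle_not_mem hr hr' hnull
    (exists_forall_not_mem_zeroDensityPoints_compl hr A hm hcover hdisj hproper)
  obtain ⟨i, j, hij, hi, hj⟩ := exists_two_not_mem_zeroDensityPoints hcover hb
  have hfin : ∀ i j : Fin 4, i ≠ j → ∃ k₁ k₂ : Fin 4, ∀ k, k ≠ i → k ≠ j → k = k₁ ∨ k = k₂ := by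
    decide
  obtain ⟨k₁, k₂, hk⟩ := hfin i j hij
  set y := poleCircle hr hr' b with hy
  have hcol : ∀ᵐ t, y t ∈ zeroDensityPoints (A k₁)ᶜ ∨ y t ∈ zeroDensityPoints (A k₂)ᶜ := by
    filter_upwards [hae] with t ht
    obtain ⟨k, hkt⟩ : ∃ k, y t ∈ zeroDensityPoints (A k)ᶜ := by
      by_contra! h
      exact ht h
    -- A class of density one on the circle has density zero at the pole, which excludes `i` and
    -- `j`.
    have hpole := hunit k _ _ (dist_framePole_poleCircle hr hr' b t) hkt
    rcases hk k (fun h => hi (h ▸ hpole)) (fun h => hj (h ▸ hpole)) with rfl | rfl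
    · exact Or.inl hkt
    · exact Or.inr hkt
  refine ⟨y ⁻¹' zeroDensityPoints (A k₁)ᶜ,
    (continuous_poleCircle hr hr' b).measurable (measurableSet_zeroDensityPoints _), fun t => ?_, ?_⟩
  · have : y (t + 2 * Real.pi) = y t := by
      simp only [hy, poleCircle, Real.cos_add_two_pi, Real.sin_add_two_pi]
    rw [mem_preimage, this, mem_preimage]
  · filter_upwards [hcol, ae_add_right hcol θ] with t h1 h2
    have hd := dist_poleCircle_add hr hr' b hθ t
    refine ⟨fun h => hadj k₁ _ _ hd h, fun h => h1.resolve_right fun h3 => ?_⟩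
    exact hadj k₂ _ _ hd h3 (h2.resolve_left h)

/-- This is the chord condition on the circle of Euclidean radius `r * twistSin r`. The bound on `r`
keeps the argument of `arcsin` at most one. -/
theorem two_mul_sq_mul_twistSin_sq_mul_one_sub_cos (hr : 1 / 3 < r ^ 2) (hr0 : 0 < r) :
    2 * r ^ 2 * twistSin r ^ 2 *
      (1 - Real.cos (2 * Real.arcsin (r / √(4 * r ^ 2 - 1)))) = 1 := by
  have hpos : 0 < 4 * r ^ 2 - 1 := by linarith
  have hs := Real.sqrt_pos.2 hpos
  have hs2 := Real.sq_sqrt hpos.le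
  have hle : r / √(4 * r ^ 2 - 1) ≤ 1 := by
    rw [div_le_one hs]
    exact Real.le_sqrt_of_sq_le (by linarith)
  have hge : -1 ≤ r / √(4 * r ^ 2 - 1) := by
    have : 0 ≤ r / √(4 * r ^ 2 - 1) := by positivity
    linarith
  rw [Real.cos_two_mul, Real.cos_sq', Real.sin_arcsin hge hle, twistSin_sq (by linarith),
    one_sub_twistCos_zero_sq hr0.ne', div_pow, hs2]
  generalize 4 * r ^ 2 - 1 = m at hpos
  field_simp
  ring

theorem theorem1p1 (r θ c : ℝ) (hr : 1 / Real.sqrt 3 < r)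
    (hθ : θ = 2 * Real.arcsin (r / Real.sqrt (4 * r ^ 2 - 1))) (hc : θ = c * Real.pi)
    (h : Irrational c ∨
      ∃ p q : ℕ, 0 < q ∧ Nat.Coprime p q ∧ Even p ∧ c = (p : ℝ) / (q : ℝ)) :
    5 ≤ sphereMeasurableChromaticNumber r := by
  have hr0 : 0 < r := lt_trans (by positivity) hr
  have hr3 : 1 / 3 < r ^ 2 := by
    have h1 := pow_lt_pow_left₀ hr (by positivity) two_ne_zero
    rwa [div_pow, one_pow, Real.sq_sqrt (by norm_num)] at h1
  have hr4 : 1 / 4 < r ^ 2 := by linarith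
  by_contra hlt
  rw [not_le, sphereMeasurableChromaticNumber, measurableChromaticNumber, iInf_lt_iff] at hlt
  obtain ⟨k, hk⟩ := hlt
  rw [iInf_lt_iff] at hk
  obtain ⟨⟨φ, hφ⟩, hk5⟩ := hk
  have hk4 : k ≤ 4 := by
    have : k < 5 := by exact_mod_cast hk5
    omega
  -- A coloring with fewer than four colors is padded with empty classes.
  obtain ⟨B, hBm, hBper, hflip⟩ := exists_ae_flip_of_four_coloring hr0 hr4
    (hθ ▸ two_mul_sq_mul_twistSin_sq_mul_one_sub_cos hr3 hr0) (fun x => Fin.castLE hk4 (φ x))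
    (fun x y hxy heq => φ.valid (show (unitDistanceGraph _).Adj x y from hxy)
      (Fin.castLE_injective hk4 heq))
    (fun i => by
      by_cases hi : ∃ i', Fin.castLE hk4 i' = i
      · obtain ⟨i', rfl⟩ := hi
        convert hφ i' using 1
        ext x
        simp
      · convert nullMeasurableSet_empty
        exact eq_empty_of_forall_notMem fun x hx => hi ⟨φ x, hx⟩)
  rcases h with hirr | ⟨p, q, hq, hpq, ⟨m, hm⟩, hcpq⟩
  · exact not_ae_flip_of_irrational hBm hBper hc hirr hflip
  · have hqodd : Odd q := by
      rw [← Nat.not_even_iff_odd]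
      intro hqe
      have h2 := Nat.dvd_gcd (even_iff_two_dvd.1 ⟨m, hm⟩) (even_iff_two_dvd.1 hqe)
      rw [hpq] at h2
      omega
    refine not_ae_flip_of_odd hqodd (m := m) hBper ?_ hflip
    have : (q : ℝ) ≠ 0 := by positivity
    rw [hc, hcpq, hm]
    push_cast
    field_simp
    ring
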